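/- **Theorem 1 (Bengtsson and Senovilla, 2011).** Let $U\subset\{(v,r)\in\mathbb R^2 : r>0\}$ be open, let $\alpha,m:U\to\mathbb R$ be smooth, and let $U\times S^2$ carry the spherically symmetric Lorentzian metric in advanced coordinates $$ds^2=-e^{2\alpha}\Bigl(1-\frac{2m}{r}\Bigr)dv^2+2e^{\alpha}\,dv\,dr+r^2d\Omega^2 ,$$ time-oriented so that the null normals $\vec\ell=-e^{-\alpha}\partial_r$ and $\vec k=\partial_v+\frac12\bigl(1-\frac{2m}{r}\bigr)e^{\alpha}\partial_r$ of the round spheres are future-pointing. Let $\mathrm{A3H}=\{r=2m\}$ be the apparent 3-horizon, and let its non-isolated part be the set of those of its points where $W=G_{\mu\nu}k^\mu k^\nu+\sigma^2>0$, with $G$ the Einstein tensor and $\sigma^2=\sigma_{AB}\sigma^{AB}$ the shear scalar of $\vec k$ on the round sphere through the point. A closed future-trapped surface (topologically a sphere) is a smoothly embedded spacelike 2-sphere with both future null expansions negative everywhere. Let $p$ be a point of the non-isolated part of $\mathrm{A3H}$, let $O$ be an open neighbourhood of $p$, and let $\varepsilon>0$. 1. There is a closed future-trapped surface $S$, topologically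 a sphere, which has points in $\{r<2m\}$ and points in $\{r>2m\}$, which meets $\mathrm{A3H}$ only in its non-isolated part, and whose portion outside $\{r>2m\}$ is arbitrarily small: $S\cap\{r\le 2m\}\subset O$ and $\mathrm{area}(S\cap\{r\le 2m\})<\varepsilon\,\mathrm{area}(S)$. 2. Likewise, there is a closed future-trapped surface $S$, topologically a sphere, which has points in $\{r<2m\}$ and points in $\{r>2m\}$, which meets $\mathrm{A3H}$ only in its non-isolated part, and whose portion outside $\{r<2m\}$ is arbitrarily small: $S\cap\{r\ge 2m\}\subset O$ and $\mathrm{area}(S\cap\{r\ge 2m\})<\varepsilon\,\mathrm{area}(S)$. -/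

import Mathlib

open scoped Manifold ContDiff ENNReal

noncomputable section

namespace SphSym

/-! ## Lorentzian geometry in a global chart of dimension four -/

/-- Coordinate points (and coordinate components of tangent vectors) in dimension four. -/
abbrev R4 : Type := Fin 4 → ℝ

/-- A metric tensor given by its components `g x a b` in a global chart. -/
abbrev MetricField : Type := R4 → Matrix (Fin 4) (Fin 4) ℝ

/-- The coordinate partial derivative `∂_b F`. -/
def pd (b : Fin 4) (F : R4 → ℝ) (x : R4) : ℝ := fderiv ℝ F x (Pi.single b 1)

/-- The scalar product `g_x(X, Y)`. -/
def dot (g : MetricField) (x X Y : R4) : ℝ := ∑ a, ∑ b, g x a b * X a * Y b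

/-- Christoffel symbols `Γ^a_{bc}` of the Levi-Civita connection. -/
def christoffel (g : MetricField) (a b c : Fin 4) (x : R4) : ℝ :=
  (1 / 2) * ∑ d, (g x)⁻¹ a d *
    (pd b (fun y => g y d c) x + pd c (fun y => g y d b) x - pd d (fun y => g y b c) x)

/-- The Ricci tensor
`R_{bc} = ∂_a Γ^a_{bc} - ∂_c Γ^a_{ba} + Γ^a_{ad} Γ^d_{bc} - Γ^a_{cd} Γ^d_{ba}`. -/
def ricci (g : MetricField) (x : R4) : Matrix (Fin 4) (Fin 4) ℝ := fun b c =>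
  ∑ a, (pd a (christoffel g a b c) x - pd c (christoffel g a b a) x
    + ∑ d, (christoffel g a a d x * christoffel g d b c x
      - christoffel g a c d x * christoffel g d b a x))

/-- The scalar curvature `g^{bc} R_{bc}`. -/
def scalarCurvature (g : MetricField) (x : R4) : ℝ := ∑ b, ∑ c, (g x)⁻¹ b c * ricci g x b c

/-- The Einstein tensor `G_{bc} = R_{bc} - (1/2) R g_{bc}`. -/
def einstein (g : MetricField) : MetricField := fun x =>
  ricci g x - (scalarCurvature g x / 2) • g x

/-! ## Parametrized spheres in the chart -/

/-- The unit sphere of Euclidean three-space, with Mathlib's manifold structure. -/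
abbrev S2 : Type := Metric.sphere (0 : EuclideanSpace ℝ (Fin 3)) 1

/-- The differential at `ξ` of an `R4`-valued map on the sphere. -/
def push (Φ : S2 → R4) (ξ : S2) : EuclideanSpace ℝ (Fin 2) → R4 :=
  fun u => mfderiv (𝓡 2) 𝓘(ℝ, R4) Φ ξ u

/-- The basis of `T_ξ S2` (which is a copy of `ℝ²` in Mathlib) used to write components. -/
def basisVec (A : Fin 2) : EuclideanSpace ℝ (Fin 2) := EuclideanSpace.single A 1

/-- The tangent vectors `e_A` of the parametrized surface `Φ`. -/
def tangent (Φ : S2 → R4) (ξ : S2) (A : Fin 2) : R4 := push Φ ξ (basisVec A)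

/-- First fundamental form `γ_{AB} = g(e_A, e_B)`. -/
def firstForm (g : MetricField) (Φ : S2 → R4) (ξ : S2) : Matrix (Fin 2) (Fin 2) ℝ :=
  fun A B => dot g (Φ ξ) (tangent Φ ξ A) (tangent Φ ξ B)

/-- The covariant derivative `∇_{e_A} X` of a vector field `X` along the surface. -/
def covDeriv (g : MetricField) (Φ X : S2 → R4) (ξ : S2) (A : Fin 2) : R4 := fun a =>
  push X ξ (basisVec A) a
    + ∑ b, ∑ c, christoffel g a b c (Φ ξ) * tangent Φ ξ A b * X ξ c

/-- The second fundamental form `χ_{AB} = g(∇_{e_A} X, e_B)` relative to a normal field `X`. -/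
def secondForm (g : MetricField) (Φ X : S2 → R4) (ξ : S2) : Matrix (Fin 2) (Fin 2) ℝ :=
  fun A B => dot g (Φ ξ) (covDeriv g Φ X ξ A) (tangent Φ ξ B)

/-- The expansion `θ_X = γ^{AB} χ_{AB}`. -/
def expansion (g : MetricField) (Φ X : S2 → R4) (ξ : S2) : ℝ :=
  ∑ A, ∑ B, (firstForm g Φ ξ)⁻¹ A B * secondForm g Φ X ξ A B

/-- The shear `σ_{AB} = χ_{AB} - (1/2) θ γ_{AB}`. -/
def shear (g : MetricField) (Φ X : S2 → R4) (ξ : S2) : Matrix (Fin 2) (Fin 2) ℝ :=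
  secondForm g Φ X ξ - (expansion g Φ X ξ / 2) • firstForm g Φ ξ

/-- The shear scalar `σ² = σ_{AB} σ^{AB}`. -/
def shearScalar (g : MetricField) (Φ X : S2 → R4) (ξ : S2) : ℝ :=
  ∑ A, ∑ B, ∑ C, ∑ D, (firstForm g Φ ξ)⁻¹ A C * (firstForm g Φ ξ)⁻¹ B D
    * shear g Φ X ξ A B * shear g Φ X ξ C D

/-- The function `W = G(k, k) + σ²` of a surface `Φ` with null normal field `k`. -/
def wScalar (g : MetricField) (Φ k : S2 → R4) (ξ : S2) : ℝ :=
  dot (einstein g) (Φ ξ) (k ξ) (k ξ) + shearScalar g Φ k ξ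

/-- The differential at `ξ` of the inclusion of the unit sphere in Euclidean three-space. -/
def pushIncl (ξ : S2) : EuclideanSpace ℝ (Fin 2) → EuclideanSpace ℝ (Fin 3) :=
  fun u => mfderiv (𝓡 2) 𝓘(ℝ, EuclideanSpace ℝ (Fin 3))
    (fun η : S2 => (η : EuclideanSpace ℝ (Fin 3))) ξ u

/-- The Gram matrix, in the same basis of `T_ξ S2`, of the round metric of the unit sphere. -/
def roundForm (ξ : S2) : Matrix (Fin 2) (Fin 2) ℝ := fun A B =>
  inner ℝ (pushIncl ξ (basisVec A)) (pushIncl ξ (basisVec B))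

/-- The area, in the metric induced by `g`, of the piece `Φ(P)` of the surface `Φ`. The area
element is `√(det γ / det γ_round)` times the standard surface measure of the unit sphere. -/
def area (g : MetricField) (Φ : S2 → R4) (P : Set S2) : ℝ≥0∞ :=
  ∫⁻ ξ in P, ENNReal.ofReal (Real.sqrt ((firstForm g Φ ξ).det / (roundForm ξ).det))
    ∂(MeasureTheory.volume : MeasureTheory.Measure (EuclideanSpace ℝ (Fin 3))).toSphere

/-- `X` is a smooth field of future-pointing null normals along `Φ`; `T` is a timelike vector
field that fixes the future. -/
structure IsFutureNullNormal (g : MetricField) (T : R4 → R4) (Φ X : S2 → R4) : Prop where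
  smooth : ContMDiff (𝓡 2) 𝓘(ℝ, R4) ∞ X
  null : ∀ ξ, dot g (Φ ξ) (X ξ) (X ξ) = 0
  normal : ∀ ξ A, dot g (Φ ξ) (X ξ) (tangent Φ ξ A) = 0
  future : ∀ ξ, dot g (Φ ξ) (X ξ) (T (Φ ξ)) < 0

/-- `Φ` parametrizes a closed future-trapped surface, topologically a sphere, in the open region
`M` with metric `g` time-oriented by `T`: a smoothly embedded spacelike sphere both of whose
future null expansions are negative. (An injective immersion of a compact manifold is an
embedding; positive definiteness of the first fundamental form makes `Φ` an immersion.) -/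
structure IsFutureTrappedSphere (g : MetricField) (T : R4 → R4) (M : Set R4)
    (Φ : S2 → R4) : Prop where
  smooth : ContMDiff (𝓡 2) 𝓘(ℝ, R4) ∞ Φ
  injective : Function.Injective Φ
  mem : ∀ ξ, Φ ξ ∈ M
  spacelike : ∀ ξ, (firstForm g Φ ξ).PosDef
  trapped : ∃ k l : S2 → R4, IsFutureNullNormal g T Φ k ∧ IsFutureNullNormal g T Φ l ∧
    (∀ ξ, dot g (Φ ξ) (k ξ) (l ξ) = -1) ∧
    ∀ ξ, expansion g Φ k ξ < 0 ∧ expansion g Φ l ξ < 0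

/-! ## Spherically symmetric spacetimes in advanced coordinates

The spacetime with coordinates `(v, r) ∈ U`, `r > 0`, and round spheres is described in the global
chart `(v, x) ∈ ℝ × ℝ³`, where `x = r ξ` with `ξ` in the unit sphere. Since
`r² dΩ² = |dx|² - dr²`, the line element reads
`-e^{2α} (1 - 2m/r) dv² + 2 e^α dv dr + (|dx|² - dr²)`. -/

/-- The area radius `r = |x|`. -/
def rad (x : R4) : ℝ := Real.sqrt (x 1 ^ 2 + x 2 ^ 2 + x 3 ^ 2)

/-- A function of `(v, r)` evaluated at a spacetime point. -/
def ev (F : ℝ × ℝ → ℝ) (x : R4) : ℝ := F (x 0, rad x)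

/-- The components of `dv`, and also of the vector field `∂_v`. -/
def dv : R4 := ![1, 0, 0, 0]

/-- The components of `dr`, and also of the vector field `∂_r` (at fixed `v` and angles). -/
def dr (x : R4) : R4 := ![0, x 1 / rad x, x 2 / rad x, x 3 / rad x]

/-- The spacetime region `{(v, x) : (v, |x|) ∈ U}`. -/
def spacetime (U : Set (ℝ × ℝ)) : Set R4 := {x | (x 0, rad x) ∈ U}

/-- The spherically symmetric metric with functions `α` and `m` of `(v, r)`. -/
def metric (α m : ℝ × ℝ → ℝ) : MetricField := fun x a b =>
  -(Real.exp (2 * ev α x) * (1 - 2 * ev m x / rad x)) * dv a * dv b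
    + Real.exp (ev α x) * (dv a * dr x b + dr x a * dv b)
    + ((if a = b then 1 else 0) - dv a * dv b - dr x a * dr x b)

/-- The null normal `k = ∂_v + (1/2) (1 - 2m/r) e^α ∂_r` of the round spheres. -/
def kSph (α m : ℝ × ℝ → ℝ) (x : R4) : R4 :=
  dv + ((1 / 2) * (1 - 2 * ev m x / rad x) * Real.exp (ev α x)) • dr x

/-- The null normal `ℓ = -e^{-α} ∂_r` of the round spheres. -/
def lSph (α : ℝ × ℝ → ℝ) (x : R4) : R4 := -(Real.exp (-ev α x)) • dr x

/-- The time orientation, for which `k` and `ℓ` are future-pointing: the timelike field `k + ℓ`. -/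
def timeDir (α m : ℝ × ℝ → ℝ) (x : R4) : R4 := kSph α m x + lSph α x

/-- The round sphere with coordinates `(v, r)`. -/
def roundSphere (v r : ℝ) (ξ : S2) : R4 := ![v, r * ξ.1 0, r * ξ.1 1, r * ξ.1 2]

/-- The apparent 3-horizon `r = 2m`. -/
def A3H (U : Set (ℝ × ℝ)) (m : ℝ × ℝ → ℝ) : Set R4 := {x ∈ spacetime U | rad x = 2 * ev m x}

/-- The non-isolated part of the apparent 3-horizon, filled by the marginally trapped round
spheres on which `W > 0`. -/
def nonIsolatedA3H (U : Set (ℝ × ℝ)) (α m : ℝ × ℝ → ℝ) : Set R4 :=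
  {x ∈ A3H U m | ∃ ξ : S2, x = roundSphere (x 0) (rad x) ξ ∧
    0 < wScalar (metric α m) (roundSphere (x 0) (rad x))
      (fun ξ' => kSph α m (roundSphere (x 0) (rad x) ξ')) ξ}

/-- The region `r < 2m` of trapped round spheres. -/
def trappedSide (m : ℝ × ℝ → ℝ) : Set R4 := {x | rad x < 2 * ev m x}

/-- The region `r > 2m` of untrapped round spheres. -/
def untrappedSide (m : ℝ × ℝ → ℝ) : Set R4 := {x | 2 * ev m x < rad x}

/-- `Φ` has points on both sides of the apparent 3-horizon and meets it only in its
non-isolated part. -/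
def CrossesNonIsolatedA3H (U : Set (ℝ × ℝ)) (α m : ℝ × ℝ → ℝ) (Φ : S2 → R4) : Prop :=
  (Set.range Φ ∩ trappedSide m).Nonempty ∧ (Set.range Φ ∩ untrappedSide m).Nonempty ∧
    Set.range Φ ∩ A3H U m ⊆ nonIsolatedA3H U α m

/-- The portion of the surface `Φ` outside the region `R` is small: it is contained in `O`, and
it takes up less than the fraction `ε` of the area of the surface. -/
def PortionOutsideSmall (g : MetricField) (Φ : S2 → R4) (R O : Set R4) (ε : ℝ) : Prop :=
  Set.range Φ \ R ⊆ O ∧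
    area g Φ (Φ ⁻¹' Rᶜ) < ENNReal.ofReal ε * area g Φ Set.univ

end SphSym

end

/-! Write the metric as `-N dv² + 2E dv dr + r² dΩ²` with `E = e^α` and `N = e^{2α}(1 - 2m/r)`; the
sign of `N` tells the two sides of the horizon apart. On a round sphere with `N = 0` the normal `k`
is `∂_v`, its second fundamental form vanishes, and `W = R_vv = -N_v/(E r)` (`ricci_advMetric`,
`wScalar_horizon`). Non-isolated therefore means `N_v < 0`, an open condition.

Let `n` be the direction of `p` and `z = ⟪n, ξ⟫`. Deform the round sphere through `p` to `v = v₀ + ε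
h(z)`, `r = r₀ + ε f(z)`. For small `ε` the ingoing expansion stays negative. The outgoing one
vanishes at `ε = 0`, and its first-order part is a positive multiple of `r₀ ν/E² - Δf`, where `ν =
N_v h + N_r f` is the first-order change of `N` and `Δ` is the Laplacian of the unit sphere
(`eventually_trappedAt`). Since `N_v ≠ 0`, a suitable `h` produces any prescribed `ν`. The choice `ν
= (Δf - d) E²/r₀` with `d > 0` makes the surface trapped whatever `f` is, and the side of the
horizon on which a point lies is then decided by the sign of `Δf - d`.

As `Δf` has mean zero it cannot exceed `d` everywhere, but it can do so off an arbitrarily small cap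
about `n`: `f = e^{Mz}` with `M` large (`exists_axLaplacian_pos`). This gives the first claim, and
`-f` in place of `f` gives the second (`exists_trapped_curve`). Area elements stay within a factor 2
of the round one, so a cap of small measure has small area (`area_lt`).

The limits in `ε` rest on exact formulas for axisymmetric graphs. All forms involved are
combinations of the round metric and `dz ⊗ dz` (`expansion_mul_eq`), and the symmetrized second form
is a Lie derivative of the metric (`secondForm_add_swap`), so expansions need no Christoffel
symbols. -/

noncomputable section

namespace SphSym

/-! ### The unit sphere: tangent planes, round metric, and the one-form `dz` -/

lemma fact_finrank_three : Fact (Module.finrank ℝ (EuclideanSpace ℝ (Fin 3)) = 2 + 1) :=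
  ⟨finrank_euclideanSpace_fin⟩

lemma inner_fin_three (x y : EuclideanSpace ℝ (Fin 3)) :
    inner ℝ x y = x 0 * y 0 + x 1 * y 1 + x 2 * y 2 := by
  simp [PiLp.inner_apply, Fin.sum_univ_three, mul_comm]

lemma sphere_coord_sq (ξ : S2) : ξ.1 0 ^ 2 + ξ.1 1 ^ 2 + ξ.1 2 ^ 2 = 1 := by
  have h : inner ℝ ξ.1 ξ.1 = (1 : ℝ) := by
    rw [real_inner_self_eq_norm_sq, norm_eq_of_mem_sphere]; norm_num
  rw [inner_fin_three] at h
  linarith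

/-- The differential of the inclusion of the sphere as a continuous linear map. -/
def dIncl (ξ : S2) : EuclideanSpace ℝ (Fin 2) →L[ℝ] EuclideanSpace ℝ (Fin 3) :=
  mfderiv (𝓡 2) 𝓘(ℝ, EuclideanSpace ℝ (Fin 3)) (fun η : S2 => (η : EuclideanSpace ℝ (Fin 3))) ξ

lemma pushIncl_eq (ξ : S2) (u : EuclideanSpace ℝ (Fin 2)) : pushIncl ξ u = dIncl ξ u := rfl

lemma dIncl_injective (ξ : S2) : Function.Injective (dIncl ξ) :=
  haveI := fact_finrank_three
  injective_mvfderiv_subtypeVal_sphere (n := 2) ξ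

lemma range_dIncl (ξ : S2) : (dIncl ξ).range = (ℝ ∙ (ξ : EuclideanSpace ℝ (Fin 3)))ᗮ :=
  haveI := fact_finrank_three
  range_mvfderiv_subtypeVal (n := 2) ξ

lemma inner_pushIncl (ξ : S2) (u : EuclideanSpace ℝ (Fin 2)) :
    inner ℝ ξ.1 (pushIncl ξ u) = (0 : ℝ) := by
  have : pushIncl ξ u ∈ (ℝ ∙ (ξ : EuclideanSpace ℝ (Fin 3)))ᗮ := by
    rw [← range_dIncl]; exact ⟨u, rfl⟩
  exact Submodule.mem_orthogonal_singleton_iff_inner_right.1 this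

/-- The derivative along the sphere of the restriction of an ambient map. -/
lemma push_restrict {Ψ : EuclideanSpace ℝ (Fin 3) → R4} {Ψ' : EuclideanSpace ℝ (Fin 3) →L[ℝ] R4}
    {ξ : S2} (h : HasFDerivAt Ψ Ψ' ξ.1) (u : EuclideanSpace ℝ (Fin 2)) :
    push (fun η : S2 => Ψ η.1) ξ u = Ψ' (pushIncl ξ u) := by
  have := fact_finrank_three
  have h1 : HasMFDerivAt 𝓘(ℝ, EuclideanSpace ℝ (Fin 3)) 𝓘(ℝ, R4) Ψ ξ.1 Ψ' :=
    h.hasMFDerivAt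
  have h2 : HasMFDerivAt (𝓡 2) 𝓘(ℝ, EuclideanSpace ℝ (Fin 3))
      (fun η : S2 => (η : EuclideanSpace ℝ (Fin 3))) ξ (dIncl ξ) :=
    ((contMDiff_coe_sphere (m := 1) (n := 2) ξ).mdifferentiableAt (by norm_num)).hasMFDerivAt
  have h3 := (HasMFDerivAt.comp ξ h1 h2).mfderiv
  unfold push
  change (mfderiv (𝓡 2) 𝓘(ℝ, R4) (Ψ ∘ (fun η : S2 => (η : EuclideanSpace ℝ (Fin 3)))) ξ) u = _
  rw [h3]; rfl

/-- The tangential component of an ambient covector `n` in the basis of the tangent plane. -/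
def axisComp (n : EuclideanSpace ℝ (Fin 3)) (ξ : S2) (A : Fin 2) : ℝ :=
  inner ℝ n (pushIncl ξ (basisVec A))

lemma dIncl_eq_sum (ξ : S2) (u : EuclideanSpace ℝ (Fin 2)) :
    dIncl ξ u = u 0 • pushIncl ξ (basisVec 0) + u 1 • pushIncl ξ (basisVec 1) := by
  have : u = u 0 • basisVec 0 + u 1 • basisVec 1 := by
    ext i; fin_cases i <;> simp [basisVec]
  conv_lhs => rw [this]
  simp [pushIncl_eq]

lemma roundForm_symm (ξ : S2) (A B : Fin 2) : roundForm ξ A B = roundForm ξ B A :=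
  real_inner_comm _ _

lemma norm_sq_combination (ξ : S2) (x : Fin 2 → ℝ) :
    ‖x 0 • pushIncl ξ (basisVec 0) + x 1 • pushIncl ξ (basisVec 1)‖ ^ 2 =
      x 0 ^ 2 * roundForm ξ 0 0 + 2 * x 0 * x 1 * roundForm ξ 0 1 + x 1 ^ 2 * roundForm ξ 1 1 := by
  rw [← real_inner_self_eq_norm_sq]
  simp only [inner_add_left, inner_add_right, inner_smul_left, inner_smul_right, roundForm,
    RCLike.conj_to_real]
  rw [real_inner_comm (pushIncl ξ (basisVec 0)) (pushIncl ξ (basisVec 1))]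
  ring

lemma combination_ne_zero (ξ : S2) {x : Fin 2 → ℝ} (hx : x ≠ 0) :
    x 0 • pushIncl ξ (basisVec 0) + x 1 • pushIncl ξ (basisVec 1) ≠ 0 := by
  intro h
  have h2 := dIncl_eq_sum ξ (WithLp.toLp 2 x)
  simp only [h] at h2
  have h3 : (WithLp.toLp 2 x : EuclideanSpace ℝ (Fin 2)) = 0 :=
    dIncl_injective ξ (h2.trans (map_zero _).symm)
  apply hx
  ext i
  exact congrArg (fun w : EuclideanSpace ℝ (Fin 2) => w i) h3

lemma roundForm_zero_zero_pos (ξ : S2) : 0 < roundForm ξ 0 0 := by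
  have h := norm_sq_combination ξ ![1, 0]
  have h' := combination_ne_zero ξ (x := ![1, 0]) (by simp)
  simp only [Matrix.cons_val_zero, Matrix.cons_val_one] at h h'
  have : 0 < ‖(1:ℝ) • pushIncl ξ (basisVec 0) + (0:ℝ) • pushIncl ξ (basisVec 1)‖ ^ 2 :=
    pow_pos (norm_pos_iff.2 h') 2
  linarith

lemma roundForm_det_pos (ξ : S2) : 0 < (roundForm ξ).det := by
  have h0 := roundForm_zero_zero_pos ξ
  -- The vector with these coefficients has squared length `γ₀₀ det γ`.
  have h := norm_sq_combination ξ ![-roundForm ξ 0 1, roundForm ξ 0 0]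
  have h' := combination_ne_zero ξ (x := ![-roundForm ξ 0 1, roundForm ξ 0 0])
    (by intro h; have := congrFun h 1; simp at this; exact h0.ne' this)
  simp only [Matrix.cons_val_zero, Matrix.cons_val_one] at h h'
  have h2 := pow_pos (norm_pos_iff.2 h') 2
  rw [h] at h2
  rw [Matrix.det_fin_two, roundForm_symm ξ 1 0]
  have : 0 < roundForm ξ 0 0 * (roundForm ξ 0 0 * roundForm ξ 1 1 - roundForm ξ 0 1 * roundForm ξ 0 1) := by
    linarith
  exact (pos_iff_pos_of_mul_pos this).1 h0

/-- The tangential part of a unit vector `n` at `ξ` has squared length `1 - ⟪n, ξ⟫²`. -/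
lemma axisComp_adjugate (n ξ : S2) :
    roundForm ξ 0 0 * axisComp n.1 ξ 1 ^ 2 + roundForm ξ 1 1 * axisComp n.1 ξ 0 ^ 2
      - 2 * roundForm ξ 0 1 * axisComp n.1 ξ 0 * axisComp n.1 ξ 1
      = (roundForm ξ).det * (1 - inner ℝ n.1 ξ.1 ^ 2) := by
  set z : ℝ := inner ℝ n.1 ξ.1 with hz
  have hξ : inner ℝ ξ.1 ξ.1 = (1 : ℝ) := by
    rw [real_inner_self_eq_norm_sq, norm_eq_of_mem_sphere]; norm_num
  have hn : inner ℝ n.1 n.1 = (1 : ℝ) := by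
    rw [real_inner_self_eq_norm_sq, norm_eq_of_mem_sphere]; norm_num
  -- With `c` the coordinates of the tangential part of `n`, the components of `dz` are `γ c` and
  -- `γ(c, c) = 1 - z²`; the claim becomes `adj(γ)(γc, γc) = det γ · γ(c, c)`.
  have hmem : n.1 - z • ξ.1 ∈ (dIncl ξ).range := by
    rw [range_dIncl, Submodule.mem_orthogonal_singleton_iff_inner_right, inner_sub_right,
      inner_smul_right, hξ, real_inner_comm, hz]; ring
  obtain ⟨c, hc⟩ := hmem
  have hc' : n.1 - z • ξ.1 = c 0 • pushIncl ξ (basisVec 0) + c 1 • pushIncl ξ (basisVec 1) := by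
    rw [← dIncl_eq_sum]; exact hc.symm
  have ht : ∀ A, axisComp n.1 ξ A = c 0 * roundForm ξ 0 A + c 1 * roundForm ξ 1 A := by
    intro A
    have : axisComp n.1 ξ A = inner ℝ (n.1 - z • ξ.1) (pushIncl ξ (basisVec A)) := by
      rw [inner_sub_left, inner_smul_left, inner_pushIncl]; simp [axisComp]
    rw [this, hc', inner_add_left, inner_smul_left, inner_smul_left]; rfl
  have hs : 1 - z ^ 2 = c 0 ^ 2 * roundForm ξ 0 0 + 2 * c 0 * c 1 * roundForm ξ 0 1
      + c 1 ^ 2 * roundForm ξ 1 1 := by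
    rw [← norm_sq_combination ξ (fun i => c i), ← hc', ← real_inner_self_eq_norm_sq]
    simp only [inner_sub_left, inner_sub_right, inner_smul_left, inner_smul_right,
      RCLike.conj_to_real, hξ, hn]
    rw [real_inner_comm n.1 ξ.1, ← hz]; ring
  rw [hs, ht 0, ht 1, Matrix.det_fin_two, roundForm_symm ξ 1 0]
  ring

lemma inner_self_sphere (ξ : S2) : inner ℝ ξ.1 ξ.1 = (1 : ℝ) := by
  rw [real_inner_self_eq_norm_sq, norm_eq_of_mem_sphere]; norm_num

/-! ### Fundamental forms spanned by the round metric and `dz ⊗ dz` -/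

/-- The determinant of a first fundamental form that is invariant under rotations about `n`. -/
lemma firstForm_det {g : MetricField} {Φ : S2 → R4} {n ξ : S2} {q P : ℝ}
    (h : ∀ A B, firstForm g Φ ξ A B = q * roundForm ξ A B + P * (axisComp n.1 ξ A * axisComp n.1 ξ B)) :
    (firstForm g Φ ξ).det = (roundForm ξ).det * (q * (q + P * (1 - inner ℝ n.1 ξ.1 ^ 2))) := by
  have := axisComp_adjugate n ξ
  rw [Matrix.det_fin_two] at this ⊢
  rw [Matrix.det_fin_two]
  simp only [h]
  rw [roundForm_symm ξ 1 0] at this ⊢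
  linear_combination q * P * this

/-- Relative to the round metric the eigenvalues are `q` and `q + P|dz|²`. For `P ≥ 0` the first
suffices; for `P < 0` the Cauchy–Schwarz inequality for `dz` reduces the claim to the second. -/
lemma firstForm_posDef {g : MetricField} {Φ : S2 → R4} {n ξ : S2} {q P : ℝ}
    (h : ∀ A B, firstForm g Φ ξ A B = q * roundForm ξ A B + P * (axisComp n.1 ξ A * axisComp n.1 ξ B))
    (hq : 0 < q) (hP : 0 < q + P * (1 - inner ℝ n.1 ξ.1 ^ 2)) : (firstForm g Φ ξ).PosDef := by
  set s : ℝ := 1 - inner ℝ n.1 ξ.1 ^ 2 with hs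
  have hdet := roundForm_det_pos ξ
  have h00 := roundForm_zero_zero_pos ξ
  have hadj := axisComp_adjugate n ξ
  refine Matrix.PosDef.of_dotProduct_mulVec_pos ?_ ?_
  · ext A B
    simp only [Matrix.conjTranspose_apply, star_trivial, h, roundForm_symm ξ B A]
    ring
  · intro x hx
    have hpos := pow_pos (norm_pos_iff.2 (combination_ne_zero ξ hx)) 2
    rw [norm_sq_combination] at hpos
    have key : star x ⬝ᵥ (firstForm g Φ ξ).mulVec x =
        q * (x 0 ^ 2 * roundForm ξ 0 0 + 2 * x 0 * x 1 * roundForm ξ 0 1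
          + x 1 ^ 2 * roundForm ξ 1 1)
        + P * (x 0 * axisComp n.1 ξ 0 + x 1 * axisComp n.1 ξ 1) ^ 2 := by
      simp only [dotProduct, Matrix.mulVec, Fin.sum_univ_two, star_trivial, Pi.star_apply, h,
        roundForm_symm ξ 1 0]
      ring
    rw [key]
    set Q := x 0 ^ 2 * roundForm ξ 0 0 + 2 * x 0 * x 1 * roundForm ξ 0 1 + x 1 ^ 2 * roundForm ξ 1 1
    have hcs : (x 0 * axisComp n.1 ξ 0 + x 1 * axisComp n.1 ξ 1) ^ 2 ≤ s * Q := by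
      rw [Matrix.det_fin_two, roundForm_symm ξ 1 0] at hadj hdet
      -- The Cauchy–Schwarz defect times the determinant is a perfect square.
      have e : (roundForm ξ 0 0 * roundForm ξ 1 1 - roundForm ξ 0 1 * roundForm ξ 0 1)
          * (s * Q - (x 0 * axisComp n.1 ξ 0 + x 1 * axisComp n.1 ξ 1) ^ 2)
          = ((x 0 * roundForm ξ 0 0 + x 1 * roundForm ξ 0 1) * axisComp n.1 ξ 1
            - (x 0 * roundForm ξ 0 1 + x 1 * roundForm ξ 1 1) * axisComp n.1 ξ 0) ^ 2 := by
        linear_combination (-Q) * hadj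
      have := (mul_nonneg_iff_of_pos_left hdet).1 (e ▸ sq_nonneg _)
      linarith
    rcases le_or_gt 0 P with h1 | h1
    · have := mul_pos hq hpos
      have := mul_nonneg h1 (sq_nonneg (x 0 * axisComp n.1 ξ 0 + x 1 * axisComp n.1 ξ 1))
      linarith
    · have := mul_pos hP hpos
      have := mul_le_mul_of_nonpos_left hcs h1.le
      nlinarith

/-- The expansion of a null normal in a situation invariant under rotations about `n`. -/
lemma expansion_mul_eq {g : MetricField} {Φ X : S2 → R4} {n ξ : S2} {q P a b : ℝ}
    (h : ∀ A B, firstForm g Φ ξ A B = q * roundForm ξ A B + P * (axisComp n.1 ξ A * axisComp n.1 ξ B))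
    (hX : ∀ A B, secondForm g Φ X ξ A B + secondForm g Φ X ξ B A =
      2 * (a * roundForm ξ A B + b * (axisComp n.1 ξ A * axisComp n.1 ξ B)))
    (hq : q ≠ 0) (hP : q + P * (1 - inner ℝ n.1 ξ.1 ^ 2) ≠ 0) :
    expansion g Φ X ξ * (q * (q + P * (1 - inner ℝ n.1 ξ.1 ^ 2))) =
      2 * q * a + (q * b + P * a) * (1 - inner ℝ n.1 ξ.1 ^ 2) := by
  have hdet := firstForm_det h
  have hrd := (roundForm_det_pos ξ).ne'
  have hadj := axisComp_adjugate n ξ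
  set s : ℝ := 1 - inner ℝ n.1 ξ.1 ^ 2 with hs
  have hne : (firstForm g Φ ξ).det ≠ 0 := by
    rw [hdet]; exact mul_ne_zero hrd (mul_ne_zero hq hP)
  -- The trace uses the symmetric adjugate of `γ`, so the off-diagonal second form enters only
  -- through its symmetrization, which is all that `hX` controls.
  have e : expansion g Φ X ξ * (firstForm g Φ ξ).det =
      firstForm g Φ ξ 1 1 * secondForm g Φ X ξ 0 0 + firstForm g Φ ξ 0 0 * secondForm g Φ X ξ 1 1
      - firstForm g Φ ξ 0 1 * (secondForm g Φ X ξ 0 1 + secondForm g Φ X ξ 1 0) := by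
    have h01 : firstForm g Φ ξ 1 0 = firstForm g Φ ξ 0 1 := by
      rw [h, h, roundForm_symm ξ 1 0]; ring
    unfold expansion
    simp only [Fin.sum_univ_two, Matrix.inv_def, Ring.inverse_eq_inv', Matrix.smul_apply,
      Matrix.adjugate_fin_two, Matrix.of_apply, Matrix.cons_val_zero, Matrix.cons_val_one,
      Matrix.cons_val', Matrix.cons_val_fin_one, smul_eq_mul, h01]
    field_simp
    ring
  have h00 := hX 0 0
  have h11 := hX 1 1
  rw [hX 0 1, show secondForm g Φ X ξ 0 0 = a * roundForm ξ 0 0 + b * (axisComp n.1 ξ 0 * axisComp n.1 ξ 0) by linarith,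
    show secondForm g Φ X ξ 1 1 = a * roundForm ξ 1 1 + b * (axisComp n.1 ξ 1 * axisComp n.1 ξ 1) by linarith,
    h, h, h, hdet] at e
  apply mul_left_cancel₀ hrd
  rw [Matrix.det_fin_two, roundForm_symm ξ 1 0] at *
  linear_combination e + (q * b + P * a) * hadj

/-! ### Contractions of Christoffel symbols -/

/-- The Christoffel symbols of the first kind, up to the factor `1 / 2`. -/
def christoffelLow (g : MetricField) (d b c : Fin 4) (x : R4) : ℝ :=
  pd b (fun y => g y d c) x + pd c (fun y => g y d b) x - pd d (fun y => g y b c) x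

lemma dot_add_left (g : MetricField) (x X Y Z : R4) :
    dot g x (X + Y) Z = dot g x X Z + dot g x Y Z := by
  simp only [dot, ← Finset.sum_add_distrib, Pi.add_apply]
  exact Finset.sum_congr rfl fun a _ => Finset.sum_congr rfl fun b _ => by ring

/-- Lowering the upper index cancels the inverse metric, so second fundamental forms involve only
first derivatives of the metric components. -/
lemma dot_christoffel {g : MetricField} {x : R4} (hsym : ∀ a b, g x a b = g x b a)
    (hinv : g x * (g x)⁻¹ = 1) (X Y Z : R4) :
    dot g x (fun a => ∑ b, ∑ c, christoffel g a b c x * Y b * X c) Z =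
      1 / 2 * ∑ d, ∑ b, ∑ c, christoffelLow g d b c x * Y b * X c * Z d := by
  have hδ : ∀ e d, ∑ a, g x a e * (g x)⁻¹ a d = if e = d then 1 else 0 := by
    intro e d
    have := congrFun (congrFun hinv e) d
    rw [Matrix.mul_apply, Matrix.one_apply] at this
    rw [← this]
    exact Finset.sum_congr rfl fun a _ => by rw [hsym]
  have h1 : ∀ a, (∑ b, ∑ c, christoffel g a b c x * Y b * X c) =
      ∑ d, (g x)⁻¹ a d * (1 / 2 * ∑ b, ∑ c, christoffelLow g d b c x * Y b * X c) := by
    intro a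
    simp only [christoffel, christoffelLow, Finset.mul_sum, Finset.sum_mul]
    rw [Finset.sum_comm' (t' := Finset.univ) (s' := fun _ => Finset.univ) (by simp)]
    rw [Finset.sum_comm]
    conv_lhs => enter [2, c]; rw [Finset.sum_comm]
    rw [Finset.sum_comm]
    refine Finset.sum_congr rfl fun d _ => ?_
    exact Finset.sum_congr rfl fun b _ => Finset.sum_congr rfl fun c _ => by ring
  set w : Fin 4 → ℝ := fun d => 1 / 2 * ∑ b, ∑ c, christoffelLow g d b c x * Y b * X c with hw
  have h2 : dot g x (fun a => ∑ b, ∑ c, christoffel g a b c x * Y b * X c) Z = ∑ d, w d * Z d := by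
    unfold dot
    simp only [h1]
    calc ∑ a, ∑ e, g x a e * (∑ d, (g x)⁻¹ a d * w d) * Z e
        = ∑ e, ∑ d, (∑ a, g x a e * (g x)⁻¹ a d) * (w d * Z e) := by
          rw [Finset.sum_comm]
          refine Finset.sum_congr rfl fun e _ => ?_
          simp only [Finset.mul_sum, Finset.sum_mul]
          rw [Finset.sum_comm]
          exact Finset.sum_congr rfl fun b _ => Finset.sum_congr rfl fun c _ => by ring
      _ = ∑ d, w d * Z d := by simp [hδ]
  rw [h2, hw, Finset.mul_sum]
  refine Finset.sum_congr rfl fun d _ => ?_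
  simp only [Finset.mul_sum, Finset.sum_mul]
  exact Finset.sum_congr rfl fun b _ => Finset.sum_congr rfl fun c _ => by ring

/-- The symmetrized second fundamental form is half the Lie derivative of the metric. -/
lemma secondForm_add_swap {g : MetricField} {Φ X : S2 → R4} {ξ : S2}
    (hsym : ∀ y a b, g y a b = g y b a) (hinv : g (Φ ξ) * (g (Φ ξ))⁻¹ = 1) (A B : Fin 2) :
    secondForm g Φ X ξ A B + secondForm g Φ X ξ B A =
      dot g (Φ ξ) (push X ξ (basisVec A)) (tangent Φ ξ B)
      + dot g (Φ ξ) (push X ξ (basisVec B)) (tangent Φ ξ A)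
      + ∑ a, ∑ b, (∑ c, pd c (fun y => g y a b) (Φ ξ) * X ξ c)
        * tangent Φ ξ A a * tangent Φ ξ B b := by
  have hs : ∀ A B, secondForm g Φ X ξ A B =
      dot g (Φ ξ) (push X ξ (basisVec A)) (tangent Φ ξ B) +
      1 / 2 * ∑ d, ∑ b, ∑ c, christoffelLow g d b c (Φ ξ) * tangent Φ ξ A b * X ξ c
        * tangent Φ ξ B d := by
    intro A B
    rw [← dot_christoffel (hsym _) hinv, ← dot_add_left]
    rfl
  rw [hs, hs]
  have hpd : ∀ c a b, pd c (fun y => g y a b) (Φ ξ) = pd c (fun y => g y b a) (Φ ξ) := by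
    intro c a b; congr 1; ext y; exact hsym y a b
  -- The part `∂_b g_{dc} - ∂_d g_{bc}` is antisymmetric in `b, d` and cancels on exchanging `A` and
  -- `B`; `∂_c g_{db}` survives twice.
  have key : (∑ d, ∑ b, ∑ c, christoffelLow g d b c (Φ ξ) * tangent Φ ξ A b * X ξ c
        * tangent Φ ξ B d) + (∑ d, ∑ b, ∑ c, christoffelLow g d b c (Φ ξ) * tangent Φ ξ B b * X ξ c
        * tangent Φ ξ A d) = 2 * ∑ a, ∑ b, (∑ c, pd c (fun y => g y a b) (Φ ξ) * X ξ c)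
        * tangent Φ ξ A a * tangent Φ ξ B b := by
    rw [Finset.sum_comm, ← Finset.sum_add_distrib, Finset.mul_sum]
    refine Finset.sum_congr rfl fun a _ => ?_
    rw [← Finset.sum_add_distrib, Finset.mul_sum]
    refine Finset.sum_congr rfl fun b _ => ?_
    rw [← Finset.sum_add_distrib, Finset.sum_mul, Finset.sum_mul, Finset.mul_sum]
    refine Finset.sum_congr rfl fun c _ => ?_
    simp only [christoffelLow]
    rw [hpd c b a, hpd a b c]
    ring
  linarith

/-- The contracted Christoffel symbols. -/
lemma sum_christoffel_self {g : MetricField} {x : R4} (hsym : ∀ y a b, g y a b = g y b a)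
    (hinv : ∀ a b, (g x)⁻¹ a b = (g x)⁻¹ b a) (d : Fin 4) :
    ∑ a, christoffel g a a d x = 1 / 2 * ∑ a, ∑ e, (g x)⁻¹ a e * pd d (fun y => g y a e) x := by
  have hpd : ∀ c a b, pd c (fun y => g y a b) x = pd c (fun y => g y b a) x := by
    intro c a b; congr 1; ext y; exact hsym y a b
  -- A symmetric inverse metric is contracted with an antisymmetric expression.
  have h : ∑ a, ∑ e, (g x)⁻¹ a e * (pd a (fun y => g y e d) x - pd e (fun y => g y a d) x) = 0 := by
    have h' : ∑ a, ∑ e, (g x)⁻¹ a e * pd a (fun y => g y e d) x =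
        ∑ a, ∑ e, (g x)⁻¹ a e * pd e (fun y => g y a d) x := by
      rw [Finset.sum_comm]
      exact Finset.sum_congr rfl fun a _ => Finset.sum_congr rfl fun e _ => by rw [hinv]
    simp only [mul_sub, Finset.sum_sub_distrib, h', sub_self]
  simp only [christoffel]
  rw [← Finset.mul_sum]
  congr 1
  rw [← sub_eq_zero, ← Finset.sum_sub_distrib, ← h]
  refine Finset.sum_congr rfl fun a _ => ?_
  rw [← Finset.sum_sub_distrib]
  refine Finset.sum_congr rfl fun e _ => ?_
  rw [hpd d a e]; ring

/-! ### Gradients of functions of `v` and `r` in the chart -/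

/-- The linear form on `R4` with components `w`. -/
def linForm (w : R4) : R4 →L[ℝ] ℝ := ∑ i, w i • ContinuousLinearMap.proj (R := ℝ) (φ := fun _ : Fin 4 => ℝ) i

lemma linForm_apply (w X : R4) : linForm w X = ∑ i, w i * X i := by
  simp [linForm]

/-- `F` is differentiable at `x` with gradient `w`. -/
def HasGrad (F : R4 → ℝ) (w : R4) (x : R4) : Prop := HasFDerivAt F (linForm w) x

lemma HasGrad.of_hasFDerivAt {F : R4 → ℝ} {w x : R4} {L : R4 →L[ℝ] ℝ} (h : HasFDerivAt F L x)
    (hL : ∀ X, L X = ∑ i, w i * X i) : HasGrad F w x := by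
  have : L = linForm w := by ext X; rw [hL, linForm_apply]
  rw [HasGrad, ← this]; exact h

lemma HasGrad.pd_eq {F : R4 → ℝ} {w x : R4} (h : HasGrad F w x) (b : Fin 4) : pd b F x = w b := by
  unfold pd
  rw [HasFDerivAt.fderiv h, linForm_apply]
  simp [Pi.single_apply]

lemma hasGrad_const (c : ℝ) (x : R4) : HasGrad (fun _ => c) 0 x :=
  .of_hasFDerivAt (hasFDerivAt_const c x) (by simp)

lemma hasGrad_coord (i : Fin 4) (x : R4) : HasGrad (fun y => y i) (Pi.single i 1) x :=
  .of_hasFDerivAt (ContinuousLinearMap.hasFDerivAt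
    (ContinuousLinearMap.proj (R := ℝ) (φ := fun _ : Fin 4 => ℝ) i)) (by simp [Pi.single_apply])

lemma HasGrad.add {F G : R4 → ℝ} {u w x : R4} (hF : HasGrad F u x) (hG : HasGrad G w x) :
    HasGrad (fun y => F y + G y) (u + w) x :=
  .of_hasFDerivAt (HasFDerivAt.add hF hG) fun X => by
    simp [linForm_apply, ← Finset.sum_add_distrib, add_mul]

lemma HasGrad.sub {F G : R4 → ℝ} {u w x : R4} (hF : HasGrad F u x) (hG : HasGrad G w x) :
    HasGrad (fun y => F y - G y) (u - w) x :=
  .of_hasFDerivAt (HasFDerivAt.sub hF hG) fun X => by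
    simp [linForm_apply, ← Finset.sum_sub_distrib, sub_mul]

lemma HasGrad.neg {F : R4 → ℝ} {u x : R4} (hF : HasGrad F u x) :
    HasGrad (fun y => -F y) (-u) x :=
  .of_hasFDerivAt (HasFDerivAt.neg hF) fun X => by
    simp [linForm_apply]

lemma HasGrad.mul {F G : R4 → ℝ} {u w x : R4} (hF : HasGrad F u x) (hG : HasGrad G w x) :
    HasGrad (fun y => F y * G y) (F x • w + G x • u) x :=
  .of_hasFDerivAt (HasFDerivAt.mul hF hG) fun X => by
    simp [linForm_apply, ← Finset.sum_add_distrib, add_mul, Finset.mul_sum, mul_assoc]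

lemma HasGrad.mul_const {F : R4 → ℝ} {u x : R4} (hF : HasGrad F u x) (c : ℝ) :
    HasGrad (fun y => F y * c) (c • u) x := by
  simpa using hF.mul (hasGrad_const c x)

lemma HasGrad.congr {F : R4 → ℝ} {u w x : R4} (hF : HasGrad F u x) (h : u = w) :
    HasGrad F w x := h ▸ hF

lemma rad_sq (x : R4) : rad x ^ 2 = x 1 ^ 2 + x 2 ^ 2 + x 3 ^ 2 := Real.sq_sqrt (by positivity)

lemma dr_sq {x : R4} (hx : 0 < rad x) : dr x 1 ^ 2 + dr x 2 ^ 2 + dr x 3 ^ 2 = 1 := by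
  have := rad_sq x
  simp only [dr, Matrix.cons_val]
  field_simp
  linarith

lemma dr_zero (x : R4) : dr x 0 = 0 := rfl

lemma hasGrad_rad {x : R4} (hx : 0 < rad x) : HasGrad rad (dr x) x := by
  have h := ((((hasGrad_coord 1 x).mul (hasGrad_coord 1 x)).add
    ((hasGrad_coord 2 x).mul (hasGrad_coord 2 x))).add ((hasGrad_coord 3 x).mul (hasGrad_coord 3 x)))
  have hne : x 1 * x 1 + x 2 * x 2 + x 3 * x 3 ≠ 0 := by
    have := rad_sq x; nlinarith
  have h2 := HasFDerivAt.sqrt h hne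
  have e : rad = fun y : R4 => Real.sqrt (y 1 * y 1 + y 2 * y 2 + y 3 * y 3) := by
    ext y; simp only [rad, pow_two]
  rw [e]
  refine .of_hasFDerivAt h2 fun X => ?_
  have e2 : Real.sqrt (x 1 * x 1 + x 2 * x 2 + x 3 * x 3) = rad x := by
    simp only [rad, pow_two]
  rw [e2]
  simp [linForm_apply, Fin.sum_univ_four, dr]
  field_simp
  ring

/-- The components of `∂_b ∂_c r`. -/
def hessRad (x : R4) (c b : Fin 4) : ℝ :=
  ((if c = b then 1 else 0) - dv c * dv b - dr x c * dr x b) / rad x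

lemma hasGrad_dr {x : R4} (hx : 0 < rad x) (c : Fin 4) :
    HasGrad (fun y => dr y c) (hessRad x c) x := by
  have hinv : HasGrad (fun y => (rad y)⁻¹) (-(rad x ^ 2)⁻¹ • dr x) x := by
    refine .of_hasFDerivAt ((hasDerivAt_inv hx.ne').comp_hasFDerivAt x (hasGrad_rad hx)) fun X => ?_
    simp [linForm_apply, Finset.mul_sum, mul_assoc]
  have key : ∀ i, i ≠ 0 → HasGrad (fun y : R4 => y i / rad y)
      (fun b => ((if i = b then 1 else 0) - x i / rad x * dr x b) / rad x) x := by
    intro i _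
    have := (hasGrad_coord i x).mul hinv
    simp only [← div_eq_mul_inv] at this
    refine this.congr ?_
    ext b
    simp [Pi.single_apply]
    by_cases h : b = i
    · subst h; simp; field_simp; ring
    · simp [h, Ne.symm h]; field_simp
  fin_cases c
  · refine (hasGrad_const 0 x).congr ?_
    ext b; fin_cases b <;> simp [hessRad, dv, dr]
  · refine (key 1 (by decide)).congr ?_
    ext b; fin_cases b <;> simp [hessRad, dv, dr]
  · refine (key 2 (by decide)).congr ?_
    ext b; fin_cases b <;> simp [hessRad, dv, dr]
  · refine (key 3 (by decide)).congr ?_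
    ext b; fin_cases b <;> simp [hessRad, dv, dr]

/-- The partial derivatives of a function of `(v, r)`. -/
def derivV (G : ℝ × ℝ → ℝ) (q : ℝ × ℝ) : ℝ := fderiv ℝ G q (1, 0)

/-- The partial derivatives of a function of `(v, r)`. -/
def derivR (G : ℝ × ℝ → ℝ) (q : ℝ × ℝ) : ℝ := fderiv ℝ G q (0, 1)

lemma fderiv_eq_derivV_derivR (G : ℝ × ℝ → ℝ) (q w : ℝ × ℝ) :
    fderiv ℝ G q w = derivV G q * w.1 + derivR G q * w.2 := by
  have : w = w.1 • ((1 : ℝ), (0 : ℝ)) + w.2 • ((0 : ℝ), (1 : ℝ)) := by ext <;> simp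
  conv_lhs => rw [this]
  rw [map_add, map_smul, map_smul]
  simp only [derivV, derivR, smul_eq_mul]; ring

lemma hasGrad_ev {G : ℝ × ℝ → ℝ} {x : R4} (hx : 0 < rad x)
    (hG : DifferentiableAt ℝ G (x 0, rad x)) :
    HasGrad (ev G) (derivV G (x 0, rad x) • dv + derivR G (x 0, rad x) • dr x) x := by
  have h := HasFDerivAt.comp x (f := fun y : R4 => (y 0, rad y)) hG.hasFDerivAt
    (HasFDerivAt.prodMk (hasGrad_coord 0 x) (hasGrad_rad hx))
  refine .of_hasFDerivAt h fun X => ?_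
  simp [fderiv_eq_derivV_derivR, linForm_apply, Fin.sum_univ_four, dv]
  ring

/-! ### The metric in advanced coordinates and its inverse -/

/-- The metric `-N dv² + 2 E dv dr + (|dx|² - dr²)`. -/
def advMetric (N E : ℝ × ℝ → ℝ) : MetricField := fun x a b =>
  -(ev N x) * dv a * dv b + ev E x * (dv a * dr x b + dr x a * dv b)
    + ((if a = b then 1 else 0) - dv a * dv b - dr x a * dr x b)

/-- The function `e^{2α} (1 - 2m/r)`. -/
def lapseN (α m : ℝ × ℝ → ℝ) (q : ℝ × ℝ) : ℝ := Real.exp (2 * α q) * (1 - 2 * m q / q.2)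

/-- The function `e^α`. -/
def expA (α : ℝ × ℝ → ℝ) (q : ℝ × ℝ) : ℝ := Real.exp (α q)

lemma metric_eq_advMetric (α m : ℝ × ℝ → ℝ) : metric α m = advMetric (lapseN α m) (expA α) := rfl

lemma advMetric_symm (N E : ℝ × ℝ → ℝ) (x : R4) (a b : Fin 4) :
    advMetric N E x a b = advMetric N E x b a := by
  simp only [advMetric, eq_comm (a := a)]; ring

/-- The components of the inverse of `advMetric`. -/
def advInv (N E : ℝ × ℝ → ℝ) (x : R4) : Matrix (Fin 4) (Fin 4) ℝ := fun a b =>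
  (dv a * dr x b + dr x a * dv b) / ev E x + ((if a = b then 1 else 0) - dv a * dv b
    - dr x a * dr x b) + ev N x / ev E x ^ 2 * (dr x a * dr x b)

lemma advMetric_mul_advInv {N E : ℝ × ℝ → ℝ} {x : R4} (hx : 0 < rad x) (hE : ev E x ≠ 0) :
    advMetric N E x * advInv N E x = 1 := by
  have hn := dr_sq hx
  ext a b
  rw [Matrix.mul_apply, Matrix.one_apply, Fin.sum_univ_four]
  simp only [advMetric, advInv, dr_zero]
  set n1 := dr x 1
  set n2 := dr x 2
  set n3 := dr x 3
  have hn' : n1 ^ 2 = 1 - n2 ^ 2 - n3 ^ 2 := by linarith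
  fin_cases a <;> fin_cases b <;> simp [dv, dr_zero] <;> field_simp <;> ring_nf <;>
    (try simp only [hn']) <;> ring

lemma advMetric_inv {N E : ℝ × ℝ → ℝ} {x : R4} (hx : 0 < rad x) (hE : ev E x ≠ 0) :
    (advMetric N E x)⁻¹ = advInv N E x :=
  Matrix.inv_eq_right_inv (advMetric_mul_advInv hx hE)

lemma advMetric_mul_inv {N E : ℝ × ℝ → ℝ} {x : R4} (hx : 0 < rad x) (hE : ev E x ≠ 0) :
    advMetric N E x * (advMetric N E x)⁻¹ = 1 := by
  rw [advMetric_inv hx hE, advMetric_mul_advInv hx hE]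

lemma advInv_symm (N E : ℝ × ℝ → ℝ) (x : R4) (a b : Fin 4) :
    advInv N E x a b = advInv N E x b a := by
  simp only [advInv, eq_comm (a := a)]; ring

lemma pd_advMetric {N E : ℝ × ℝ → ℝ} {x : R4} (hx : 0 < rad x)
    (hN : DifferentiableAt ℝ N (x 0, rad x)) (hE : DifferentiableAt ℝ E (x 0, rad x))
    (b c d : Fin 4) :
    pd b (fun y => advMetric N E y c d) x =
      -(derivV N (x 0, rad x) * dv b + derivR N (x 0, rad x) * dr x b) * dv c * dv d
      + (derivV E (x 0, rad x) * dv b + derivR E (x 0, rad x) * dr x b)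
        * (dv c * dr x d + dr x c * dv d)
      + ev E x * (dv c * hessRad x d b + hessRad x c b * dv d)
      - hessRad x c b * dr x d - dr x c * hessRad x d b := by
  have h := ((((hasGrad_ev hx hN).neg.mul_const (dv c)).mul_const (dv d)).add
    ((hasGrad_ev hx hE).mul (((hasGrad_const (dv c) x).mul (hasGrad_dr hx d)).add
      ((hasGrad_dr hx c).mul_const (dv d))))).add
    ((hasGrad_const ((if c = d then 1 else 0) - dv c * dv d) x).sub
      ((hasGrad_dr hx c).mul (hasGrad_dr hx d)))
  have := h.pd_eq b
  unfold advMetric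
  rw [this]
  simp
  ring

lemma continuous_rad : Continuous rad := by unfold rad; fun_prop

lemma isOpen_spacetime {U : Set (ℝ × ℝ)} (hU : IsOpen U) : IsOpen (spacetime U) :=
  hU.preimage ((continuous_apply 0).prodMk continuous_rad)

/-! ### The connection and the Ricci component `R_vv` -/

/-- The function `Γ^r_{vr} = -β` of `advMetric`. -/
def chrB (N E : ℝ × ℝ → ℝ) (q : ℝ × ℝ) : ℝ := derivR N q / (2 * E q)

/-- The function `Γ^r_{vv}` of `advMetric`. -/
def chrS (N E : ℝ × ℝ → ℝ) (q : ℝ × ℝ) : ℝ :=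
  (-(derivV N q / E q) + N q / E q ^ 2 * (2 * derivV E q + derivR N q)) / 2

/-- The function `Γ^v_{vv}` of `advMetric`. -/
def chrA (N E : ℝ × ℝ → ℝ) (q : ℝ × ℝ) : ℝ := derivV E q / E q + chrB N E q

/-- Symbols with one lower index `v` are enough: they give the terms of `R_vv` not covered by the
contracted symbols, and the derivative of `k = ∂_v` along horizon spheres. -/
lemma christoffel_advMetric {N E : ℝ × ℝ → ℝ} {x : R4} (hx : 0 < rad x)
    (hN : DifferentiableAt ℝ N (x 0, rad x)) (hE : DifferentiableAt ℝ E (x 0, rad x))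
    (hE0 : ev E x ≠ 0) (a d : Fin 4) :
    christoffel (advMetric N E) a 0 d x =
      dv d * (ev (chrA N E) x * dv a + ev (chrS N E) x * dr x a)
        - ev (chrB N E) x * dr x a * dr x d := by
  have hn := dr_sq hx
  simp only [christoffel, pd_advMetric hx hN hE, advMetric_inv hx hE0, Fin.sum_univ_four,
    advInv, hessRad, dr_zero]
  unfold ev at *
  simp only [chrA, chrB, chrS]
  set n1 := dr x 1
  set n2 := dr x 2
  set n3 := dr x 3
  set Nv := derivV N (x 0, rad x)
  set Nr := derivR N (x 0, rad x)
  set Ev := derivV E (x 0, rad x)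
  set Er := derivR E (x 0, rad x)
  set e := E (x 0, rad x)
  set n := N (x 0, rad x)
  have hn' : n1 ^ 2 = 1 - n2 ^ 2 - n3 ^ 2 := by linarith
  have hr := hx.ne'
  fin_cases a <;> fin_cases d <;> simp [dv, dr_zero] <;> field_simp <;> ring_nf <;>
    (try simp only [hn']) <;> ring

/-- This is `∂_d log √|det g|`; since `det g = -E²`, the function `N` drops out. -/
lemma sum_christoffel_advMetric {N E : ℝ × ℝ → ℝ} {x : R4} (hx : 0 < rad x)
    (hN : DifferentiableAt ℝ N (x 0, rad x)) (hE : DifferentiableAt ℝ E (x 0, rad x))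
    (hE0 : ev E x ≠ 0) (d : Fin 4) :
    ∑ a, christoffel (advMetric N E) a a d x =
      (derivV E (x 0, rad x) * dv d + derivR E (x 0, rad x) * dr x d) / ev E x := by
  have hn := dr_sq hx
  rw [sum_christoffel_self (advMetric_symm N E)]
  swap
  · intro a b; rw [advMetric_inv hx hE0, advInv_symm]
  simp only [pd_advMetric hx hN hE, advMetric_inv hx hE0, Fin.sum_univ_four,
    advInv, hessRad, dr_zero]
  unfold ev at *
  set n1 := dr x 1
  set n2 := dr x 2
  set n3 := dr x 3
  set Nv := derivV N (x 0, rad x)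
  set Nr := derivR N (x 0, rad x)
  set Ev := derivV E (x 0, rad x)
  set Er := derivR E (x 0, rad x)
  set e := E (x 0, rad x)
  set n := N (x 0, rad x)
  have hn' : n1 ^ 2 = 1 - n2 ^ 2 - n3 ^ 2 := by linarith
  have hn3 : n1 ^ 3 = n1 * (1 - n2 ^ 2 - n3 ^ 2) := by rw [← hn']; ring
  have hn4 : n1 ^ 4 = (1 - n2 ^ 2 - n3 ^ 2) ^ 2 := by rw [← hn']; ring
  have hr := hx.ne'
  fin_cases d <;> simp [dv, dr_zero] <;> field_simp <;> ring_nf <;>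
    (try simp only [hn', hn3, hn4]) <;> ring

lemma pd_congr {F G : R4 → ℝ} {x : R4} {S : Set R4} (hS : IsOpen S) (hx : x ∈ S)
    (h : ∀ y ∈ S, F y = G y) (b : Fin 4) : pd b F x = pd b G x := by
  unfold pd
  rw [Filter.EventuallyEq.fderiv_eq (Filter.eventuallyEq_of_mem (hS.mem_nhds hx) h)]

lemma contDiffAt_derivV {G : ℝ × ℝ → ℝ} {q : ℝ × ℝ} (h : ContDiffAt ℝ ∞ G q) :
    ContDiffAt ℝ ∞ (derivV G) q :=
  (h.fderiv_right (m := ∞) (by simp)).clm_apply contDiffAt_const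

lemma contDiffAt_derivR {G : ℝ × ℝ → ℝ} {q : ℝ × ℝ} (h : ContDiffAt ℝ ∞ G q) :
    ContDiffAt ℝ ∞ (derivR G) q :=
  (h.fderiv_right (m := ∞) (by simp)).clm_apply contDiffAt_const

lemma derivV_derivR {G : ℝ × ℝ → ℝ} {q : ℝ × ℝ} (h : ContDiffAt ℝ ∞ G q) :
    derivV (derivR G) q = derivR (derivV G) q := by
  have hd : DifferentiableAt ℝ (fderiv ℝ G) q :=
    (h.fderiv_right (m := ∞) (by simp)).differentiableAt (by simp)
  have hs := (h.isSymmSndFDerivAt (by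
    rw [minSmoothness_of_isRCLikeNormedField]
    exact WithTop.coe_le_coe.2 (le_top : (2 : ℕ∞) ≤ ⊤))).eq (1, 0) (0, 1)
  unfold derivV derivR
  rw [fderiv_clm_apply hd (by fun_prop), fderiv_clm_apply hd (by fun_prop)]
  simpa using hs

/-- The component `R_{vv}` of the Ricci tensor of `advMetric` where `N = 0`. -/
lemma ricci_advMetric {N E : ℝ × ℝ → ℝ} {U : Set (ℝ × ℝ)} (hU : IsOpen U)
    (hr : ∀ q ∈ U, 0 < q.2) (hN : ContDiffOn ℝ ∞ N U) (hE : ContDiffOn ℝ ∞ E U)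
    (hE0 : ∀ q, 0 < E q) {x : R4} (hxU : x ∈ spacetime U) (h0 : ev N x = 0) :
    ricci (advMetric N E) x 0 0 = -derivV N (x 0, rad x) / (ev E x * rad x) := by
  have hx : 0 < rad x := hr _ hxU
  have hcN : ∀ q ∈ U, ContDiffAt ℝ ∞ N q := fun q hq => hN.contDiffAt (hU.mem_nhds hq)
  have hcE : ∀ q ∈ U, ContDiffAt ℝ ∞ E q := fun q hq => hE.contDiffAt (hU.mem_nhds hq)
  have hchr : ∀ a d, ∀ y ∈ spacetime U, christoffel (advMetric N E) a 0 d y =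
      dv d * (ev (chrA N E) y * dv a + ev (chrS N E) y * dr y a)
        - ev (chrB N E) y * dr y a * dr y d := fun a d y hy =>
    christoffel_advMetric (hr _ hy) ((hcN _ hy).differentiableAt (by simp))
      ((hcE _ hy).differentiableAt (by simp)) (hE0 _).ne' a d
  set q : ℝ × ℝ := (x 0, rad x) with hq
  have hqU : q ∈ U := hxU
  have dN := (hcN q hqU).differentiableAt (by simp)
  have dE := (hcE q hqU).differentiableAt (by simp)
  have dNv := (contDiffAt_derivV (hcN q hqU)).differentiableAt (by simp)
  have dNr := (contDiffAt_derivR (hcN q hqU)).differentiableAt (by simp)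
  have dEv := (contDiffAt_derivV (hcE q hqU)).differentiableAt (by simp)
  have hEq : E q ≠ 0 := (hE0 q).ne'
  have dB' : HasFDerivAt (chrB N E) _ q :=
    dNr.hasFDerivAt.mul ((hasDerivAt_inv (by simpa using hEq)).comp_hasFDerivAt q
      (dE.hasFDerivAt.const_mul 2))
  have hBv : derivV (chrB N E) q = derivV (derivR N) q / (2 * E q)
      - derivR N q * derivV E q / (2 * E q ^ 2) := by
    rw [derivV, dB'.fderiv]
    simp [derivV]
    field_simp
    ring
  have dS' : HasFDerivAt (fun q => (-(derivV N q * (E q)⁻¹) +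
      N q * (((E q)⁻¹) ^ 2 * (2 * derivV E q + derivR N q))) * (1 / 2)) _ q :=
    ((dNv.hasFDerivAt.mul ((hasDerivAt_inv hEq).comp_hasFDerivAt q dE.hasFDerivAt)).neg.add
      (dN.hasFDerivAt.mul ((((hasDerivAt_inv hEq).comp_hasFDerivAt q dE.hasFDerivAt).pow 2).mul
        ((dEv.hasFDerivAt.const_mul 2).add dNr.hasFDerivAt)))).mul_const (1 / 2)
  have eS : chrS N E = (fun q => (-(derivV N q * (E q)⁻¹) +
      N q * (((E q)⁻¹) ^ 2 * (2 * derivV E q + derivR N q))) * (1 / 2)) := by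
    ext q; simp only [chrS]; field_simp
  have hNq : N q = 0 := h0
  have hSr : derivR (chrS N E) q = -(derivR (derivV N) q / (2 * E q))
      + derivV N q * derivR E q / (2 * E q ^ 2)
      + derivR N q * (2 * derivV E q + derivR N q) / (2 * E q ^ 2) := by
    rw [derivR, eS, dS'.fderiv]
    simp [derivR, hNq]
    field_simp
  -- The `i = 0` term is left unevaluated here and in `hpdB`: the two copies are equal and cancel in
  -- `hdiff`.
  have hpdS : ∀ i : Fin 4, pd i (christoffel (advMetric N E) i 0 0) x =
      if i = 0 then pd 0 (christoffel (advMetric N E) 0 0 0) x else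
      derivR (chrS N E) q * dr x i ^ 2 + chrS N E q * hessRad x i i := by
    intro i
    split_ifs with hi
    · rw [hi]
    have hi' : dv i = 0 := by fin_cases i <;> simp [dv] at hi ⊢
    have hv0 : dv 0 = 1 := rfl
    rw [pd_congr (isOpen_spacetime hU) hxU (G := fun y => ev (chrS N E) y * dr y i)
      (fun y hy => by rw [hchr i 0 y hy, dr_zero, hi', hv0]; ring)]
    have hS : DifferentiableAt ℝ (chrS N E) q := by rw [eS]; exact dS'.differentiableAt
    rw [((hasGrad_ev hx hS).mul (hasGrad_dr hx i)).pd_eq]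
    simp only [Pi.add_apply, Pi.smul_apply, smul_eq_mul, hi', ev, ← hq]
    ring
  have hpdB : ∀ i : Fin 4, pd 0 (christoffel (advMetric N E) i 0 i) x =
      if i = 0 then pd 0 (christoffel (advMetric N E) 0 0 0) x else
      -(derivV (chrB N E) q * dr x i ^ 2) := by
    intro i
    split_ifs with hi
    · rw [hi]
    have hi' : dv i = 0 := by fin_cases i <;> simp [dv] at hi ⊢
    have hv0 : dv 0 = 1 := rfl
    rw [pd_congr (isOpen_spacetime hU) hxU (G := fun y => -(ev (chrB N E) y * (dr y i * dr y i)))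
      (fun y hy => by rw [hchr i i y hy, hi']; ring)]
    rw [((hasGrad_ev hx dB'.differentiableAt).mul
      ((hasGrad_dr hx i).mul (hasGrad_dr hx i))).neg.pd_eq]
    have hh : hessRad x i 0 = 0 := by simp [hessRad, hi, hi', dr_zero]
    simp only [Pi.add_apply, Pi.neg_apply, Pi.smul_apply, smul_eq_mul, hv0, dr_zero, hh, ← hq]
    ring
  have hn := dr_sq hx
  have htr := sum_christoffel_advMetric hx dN dE (hE0 _).ne'
  have hquad : ∑ a, ∑ d, christoffel (advMetric N E) a a d x * christoffel (advMetric N E) d 0 0 x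
      = ∑ d, (derivV E q * dv d + derivR E q * dr x d) / E q
        * christoffel (advMetric N E) d 0 0 x := by
    rw [Finset.sum_comm]
    refine Finset.sum_congr rfl fun d _ => ?_
    rw [← Finset.sum_mul, htr]; rfl
  have hric : ricci (advMetric N E) x 0 0 =
      ∑ a, (pd a (christoffel (advMetric N E) a 0 0) x - pd 0 (christoffel (advMetric N E) a 0 a) x)
      + (∑ a, ∑ d, christoffel (advMetric N E) a a d x * christoffel (advMetric N E) d 0 0 x
      - ∑ a, ∑ d, christoffel (advMetric N E) a 0 d x * christoffel (advMetric N E) d 0 a x) := by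
    simp only [ricci, Finset.sum_add_distrib, Finset.sum_sub_distrib]
  have hdiff : ∀ i : Fin 4, pd i (christoffel (advMetric N E) i 0 0) x
      - pd 0 (christoffel (advMetric N E) i 0 i) x = if i = 0 then 0 else
      derivR (chrS N E) q * dr x i ^ 2 + chrS N E q * hessRad x i i
        + derivV (chrB N E) q * dr x i ^ 2 := by
    intro i
    by_cases hi : i = 0
    · subst hi; simp
    · rw [hpdS i, hpdB i, if_neg hi, if_neg hi, if_neg hi]; ring
  rw [hric, hquad]
  -- Equality of mixed partials removes the second derivatives of `N`. The surviving term is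
  -- `Γ^r_{vv} = -N_v/(2E)` times the trace `2/r` of the Hessian of `r`.
  simp only [hdiff, hchr _ _ x hxU, hSr, hBv, derivV_derivR (hcN q hqU)]
  simp only [Fin.sum_univ_four, ev, ← hq, chrA, chrB, chrS, hNq, hessRad, dr_zero]
  set n1 := dr x 1
  set n2 := dr x 2
  set n3 := dr x 3
  have hn' : n1 ^ 2 = 1 - n2 ^ 2 - n3 ^ 2 := by linarith
  have hn4 : n1 ^ 4 = (1 - n2 ^ 2 - n3 ^ 2) ^ 2 := by rw [← hn']; ring
  have hr0 := hx.ne'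
  have hv : dv 0 = 1 ∧ dv 1 = 0 ∧ dv 2 = 0 ∧ dv 3 = 0 := ⟨rfl, rfl, rfl, rfl⟩
  simp only [hv, if_true, Fin.reduceEq, if_false]
  field_simp
  ring_nf
  simp only [hn', hn4]
  ring

/-! ### Axisymmetric surfaces and vector fields along them -/

section

/-- The spacetime vector with `v`-component `a` and spatial part `w`. -/
def vec4 (a : ℝ) (w : EuclideanSpace ℝ (Fin 3)) : R4 := ![a, w 0, w 1, w 2]

/-- `vec4` as a continuous linear map. -/
def vec4L : ℝ × EuclideanSpace ℝ (Fin 3) →L[ℝ] R4 :=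
  LinearMap.toContinuousLinearMap
    { toFun := fun p => vec4 p.1 p.2
      map_add' := fun p q => by ext i; fin_cases i <;> simp [vec4]
      map_smul' := fun c p => by ext i; fin_cases i <;> simp [vec4] }

lemma vec4L_apply (a : ℝ) (w : EuclideanSpace ℝ (Fin 3)) : vec4L (a, w) = vec4 a w := rfl

lemma rad_vec4 (v : ℝ) {r : ℝ} (hr : 0 ≤ r) (ξ : S2) : rad (vec4 v (r • ξ.1)) = r := by
  have h := sphere_coord_sq ξ
  have : rad (vec4 v (r • ξ.1)) = Real.sqrt (r ^ 2) := by
    simp only [rad, vec4, Matrix.cons_val, PiLp.smul_apply, smul_eq_mul]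
    congr 1
    linear_combination r ^ 2 * h
  rw [this, Real.sqrt_sq hr]

lemma dr_vec4 (v : ℝ) {r : ℝ} (hr : 0 < r) (ξ : S2) : dr (vec4 v (r • ξ.1)) = vec4 0 ξ.1 := by
  ext i
  have := hr.ne'
  fin_cases i <;> simp only [dr, rad_vec4 v hr.le] <;> simp [vec4] <;> field_simp

lemma dot_advMetric (N E : ℝ × ℝ → ℝ) (v : ℝ) {r : ℝ} (hr : 0 < r) (ξ : S2) (a b : ℝ)
    (w u : EuclideanSpace ℝ (Fin 3)) :
    dot (advMetric N E) (vec4 v (r • ξ.1)) (vec4 a w) (vec4 b u) =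
      -N (v, r) * a * b + E (v, r) * (a * inner ℝ ξ.1 u + b * inner ℝ ξ.1 w)
        + inner ℝ w u - inner ℝ ξ.1 w * inner ℝ ξ.1 u := by
  simp only [dot, advMetric, dr_vec4 v hr, ev, rad_vec4 v hr.le, inner_fin_three,
    Fin.sum_univ_four]
  simp [vec4, dv]
  ring

/-- The derivative of the metric components along `X`, contracted with `Y` and `Z`. -/
lemma sum_pd_advMetric {N E : ℝ × ℝ → ℝ} (v : ℝ) {r : ℝ} (hr : 0 < r) (ξ : S2)
    (hN : DifferentiableAt ℝ N (v, r)) (hE : DifferentiableAt ℝ E (v, r)) (x y z : ℝ)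
    (wx wy wz : EuclideanSpace ℝ (Fin 3)) :
    ∑ a, ∑ b, (∑ c, pd c (fun p => advMetric N E p a b) (vec4 v (r • ξ.1)) * vec4 x wx c)
      * vec4 y wy a * vec4 z wz b =
      -(derivV N (v, r) * x + derivR N (v, r) * inner ℝ ξ.1 wx) * y * z
      + (derivV E (v, r) * x + derivR E (v, r) * inner ℝ ξ.1 wx)
        * (y * inner ℝ ξ.1 wz + z * inner ℝ ξ.1 wy)
      + E (v, r) * (y * ((inner ℝ wz wx - inner ℝ ξ.1 wz * inner ℝ ξ.1 wx) / r)
        + z * ((inner ℝ wy wx - inner ℝ ξ.1 wy * inner ℝ ξ.1 wx) / r))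
      - (inner ℝ wy wx - inner ℝ ξ.1 wy * inner ℝ ξ.1 wx) / r * inner ℝ ξ.1 wz
      - (inner ℝ wz wx - inner ℝ ξ.1 wz * inner ℝ ξ.1 wx) / r * inner ℝ ξ.1 wy := by
  have hrad := rad_vec4 v hr.le ξ
  have h0 : vec4 v (r • ξ.1) 0 = v := rfl
  have hN' : DifferentiableAt ℝ N (vec4 v (r • ξ.1) 0, rad (vec4 v (r • ξ.1))) := by
    rwa [hrad, h0]
  have hE' : DifferentiableAt ℝ E (vec4 v (r • ξ.1) 0, rad (vec4 v (r • ξ.1))) := by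
    rwa [hrad, h0]
  have h1 : ∀ a b, (∑ c, pd c (fun p => advMetric N E p a b) (vec4 v (r • ξ.1)) * vec4 x wx c) =
      -(derivV N (v, r) * x + derivR N (v, r) * inner ℝ ξ.1 wx) * dv a * dv b
      + (derivV E (v, r) * x + derivR E (v, r) * inner ℝ ξ.1 wx)
        * (dv a * vec4 0 ξ.1 b + vec4 0 ξ.1 a * dv b)
      + E (v, r) * (dv a * ((vec4 0 wx b - vec4 0 ξ.1 b * inner ℝ ξ.1 wx) / r)
        + dv b * ((vec4 0 wx a - vec4 0 ξ.1 a * inner ℝ ξ.1 wx) / r))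
      - (vec4 0 wx a - vec4 0 ξ.1 a * inner ℝ ξ.1 wx) / r * vec4 0 ξ.1 b
      - (vec4 0 wx b - vec4 0 ξ.1 b * inner ℝ ξ.1 wx) / r * vec4 0 ξ.1 a := by
    have h2 : ∀ a, ∑ c, hessRad (vec4 v (r • ξ.1)) a c * vec4 x wx c =
        (vec4 0 wx a - vec4 0 ξ.1 a * inner ℝ ξ.1 wx) / r := by
      intro a
      simp only [hessRad, hrad, dr_vec4 v hr, Fin.sum_univ_four, inner_fin_three]
      fin_cases a <;> simp [vec4, dv] <;> ring
    intro a b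
    simp only [pd_advMetric (hrad.symm ▸ hr) hN' hE', hrad, h0, ev, ← h2, dr_vec4 v hr]
    simp only [Fin.sum_univ_four, inner_fin_three, vec4, dv, Matrix.cons_val]
    ring
  simp only [h1, Fin.sum_univ_four, inner_fin_three]
  simp only [vec4, dv, Matrix.cons_val]
  ring

variable (n : S2)

/-- The field `a ∂_v + b ∂_r + c (n - ⟪n, ξ⟫ ξ)` for functions `a`, `b`, `c` of `⟪n, ξ⟫`. -/
def axisField (a b c : ℝ → ℝ) (ξ : S2) : R4 :=
  vec4 (a (inner ℝ n.1 ξ.1))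
    (b (inner ℝ n.1 ξ.1) • ξ.1 + c (inner ℝ n.1 ξ.1) • (n.1 - (inner ℝ n.1 ξ.1 : ℝ) • ξ.1))

/-- The surface `v = V`, `r = R` for functions `V` and `R` of `⟪n, ξ⟫`. -/
def axisSurface (V R : ℝ → ℝ) (ξ : S2) : R4 :=
  vec4 (V (inner ℝ n.1 ξ.1)) (R (inner ℝ n.1 ξ.1) • ξ.1)

/-- The position is itself an axial field without tangential part, so one derivative formula serves
both the surface and its normals. -/
lemma axisSurface_eq (V R : ℝ → ℝ) : axisSurface n V R = axisField n V R (fun _ => 0) := by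
  ext ξ : 1; simp [axisSurface, axisField]

variable {n}

/-- The defining formula also makes sense for `ξ` off the sphere; its ambient differential is
restricted to the tangent plane, where `dz` has components `axisComp`. -/
lemma push_axisField {a b c : ℝ → ℝ} {a' b' c' : ℝ} {ξ : S2}
    (ha : HasDerivAt a a' (inner ℝ n.1 ξ.1)) (hb : HasDerivAt b b' (inner ℝ n.1 ξ.1))
    (hc : HasDerivAt c c' (inner ℝ n.1 ξ.1)) (A : Fin 2) :
    push (axisField n a b c) ξ (basisVec A) =
      vec4 (a' * axisComp n.1 ξ A)
        ((b' * axisComp n.1 ξ A) • ξ.1 + b (inner ℝ n.1 ξ.1) • pushIncl ξ (basisVec A)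
          + (c' * axisComp n.1 ξ A) • (n.1 - (inner ℝ n.1 ξ.1 : ℝ) • ξ.1)
          - c (inner ℝ n.1 ξ.1) • (axisComp n.1 ξ A • ξ.1
            + (inner ℝ n.1 ξ.1 : ℝ) • pushIncl ξ (basisVec A))) := by
  have hz : HasFDerivAt (fun y : EuclideanSpace ℝ (Fin 3) => (inner ℝ n.1 y : ℝ))
      (innerSL ℝ n.1) ξ.1 := (innerSL ℝ n.1).hasFDerivAt
  have hid := hasFDerivAt_id (𝕜 := ℝ) ξ.1
  have h := vec4L.hasFDerivAt.comp ξ.1 ((ha.comp_hasFDerivAt ξ.1 hz).prodMk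
    (((hb.comp_hasFDerivAt ξ.1 hz).smul hid).add ((hc.comp_hasFDerivAt ξ.1 hz).smul
      ((hasFDerivAt_const n.1 ξ.1).sub (hz.smul hid)))))
  have h2 := push_restrict h (basisVec A)
  refine Eq.trans ?_ (h2.trans ?_)
  · rfl
  · rw [ContinuousLinearMap.comp_apply, ContinuousLinearMap.prod_apply, vec4L_apply]
    congr 1
    simp [axisComp]
    module

lemma tangent_axisSurface {V R : ℝ → ℝ} {V' R' : ℝ} {ξ : S2}
    (hV : HasDerivAt V V' (inner ℝ n.1 ξ.1)) (hR : HasDerivAt R R' (inner ℝ n.1 ξ.1)) (A : Fin 2) :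
    tangent (axisSurface n V R) ξ A = vec4 (V' * axisComp n.1 ξ A)
      ((R' * axisComp n.1 ξ A) • ξ.1 + R (inner ℝ n.1 ξ.1) • pushIncl ξ (basisVec A)) := by
  rw [tangent, axisSurface_eq, push_axisField hV hR (hasDerivAt_const _ (0 : ℝ))]
  simp

lemma firstForm_axisSurface {N E : ℝ × ℝ → ℝ} {V R : ℝ → ℝ} {V' R' : ℝ} {ξ : S2}
    (hV : HasDerivAt V V' (inner ℝ n.1 ξ.1)) (hR : HasDerivAt R R' (inner ℝ n.1 ξ.1))
    (hr : 0 < R (inner ℝ n.1 ξ.1)) (A B : Fin 2) :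
    firstForm (advMetric N E) (axisSurface n V R) ξ A B =
      R (inner ℝ n.1 ξ.1) ^ 2 * roundForm ξ A B
      + (-N (V (inner ℝ n.1 ξ.1), R (inner ℝ n.1 ξ.1)) * V' ^ 2
        + 2 * E (V (inner ℝ n.1 ξ.1), R (inner ℝ n.1 ξ.1)) * V' * R')
        * (axisComp n.1 ξ A * axisComp n.1 ξ B) := by
  rw [firstForm, tangent_axisSurface hV hR, tangent_axisSurface hV hR, axisSurface,
    dot_advMetric _ _ _ hr]
  simp only [inner_add_left, inner_add_right, inner_smul_left, inner_smul_right,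
    RCLike.conj_to_real, inner_self_sphere, inner_pushIncl, roundForm]
  rw [real_inner_comm ξ.1 (pushIncl ξ (basisVec A)), inner_pushIncl]
  ring

lemma dot_axisField_axisField {N E : ℝ × ℝ → ℝ} {V R : ℝ → ℝ} {ξ : S2}
    (hr : 0 < R (inner ℝ n.1 ξ.1)) (a b c a₂ b₂ c₂ : ℝ → ℝ) {z : ℝ} (hz : z = inner ℝ n.1 ξ.1) :
    dot (advMetric N E) (axisSurface n V R ξ) (axisField n a b c ξ) (axisField n a₂ b₂ c₂ ξ) =
      -N (V z, R z) * a z * a₂ z + E (V z, R z) * (a z * b₂ z + a₂ z * b z)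
        + c z * c₂ z * (1 - z ^ 2) := by
  rw [axisField, axisField, axisSurface, dot_advMetric _ _ _ hr]
  simp only [inner_add_left, inner_add_right, inner_sub_left, inner_sub_right, inner_smul_left,
    inner_smul_right, RCLike.conj_to_real, inner_self_sphere]
  rw [real_inner_comm n.1 ξ.1, ← hz]
  ring

lemma dot_axisField_tangent {N E : ℝ × ℝ → ℝ} {V R : ℝ → ℝ} {V' R' : ℝ} {ξ : S2} {z : ℝ}
    (hz : z = inner ℝ n.1 ξ.1) (hV : HasDerivAt V V' z) (hR : HasDerivAt R R' z) (hr : 0 < R z)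
    (a b c : ℝ → ℝ) (A : Fin 2) :
    dot (advMetric N E) (axisSurface n V R ξ) (axisField n a b c ξ)
      (tangent (axisSurface n V R) ξ A) =
      (-N (V z, R z) * a z * V' + E (V z, R z) * (a z * R' + b z * V') + R z * c z)
        * axisComp n.1 ξ A := by
  subst hz
  rw [tangent_axisSurface hV hR, axisField, axisSurface, dot_advMetric _ _ _ hr]
  simp only [inner_add_left, inner_add_right, inner_sub_left, inner_sub_right, inner_smul_left,
    inner_smul_right, RCLike.conj_to_real, inner_self_sphere, inner_pushIncl]
  rw [real_inner_comm n.1 ξ.1, ← axisComp]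
  ring

lemma secondForm_axisSurface {N E : ℝ × ℝ → ℝ} {V R a b c : ℝ → ℝ} {V' R' a' b' c' : ℝ} {ξ : S2}
    {z : ℝ} (hz : z = inner ℝ n.1 ξ.1) (hV : HasDerivAt V V' z) (hR : HasDerivAt R R' z)
    (ha : HasDerivAt a a' z) (hb : HasDerivAt b b' z) (hc : HasDerivAt c c' z) (hr : 0 < R z)
    (hN : DifferentiableAt ℝ N (V z, R z)) (hE : DifferentiableAt ℝ E (V z, R z))
    (hE0 : E (V z, R z) ≠ 0) (A B : Fin 2) :
    secondForm (advMetric N E) (axisSurface n V R) (axisField n a b c) ξ A B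
      + secondForm (advMetric N E) (axisSurface n V R) (axisField n a b c) ξ B A =
      2 * (R z * (b z - c z * z) * roundForm ξ A B
      + (-N (V z, R z) * a' * V' + E (V z, R z) * (a' * R' + V' * b') + R z * c'
        - (derivV N (V z, R z) * a z + derivR N (V z, R z) * b z) * V' ^ 2 / 2
        + (derivV E (V z, R z) * a z + derivR E (V z, R z) * b z) * V' * R' - c z * R')
        * (axisComp n.1 ξ A * axisComp n.1 ξ B)) := by
  subst hz
  have hrad := rad_vec4 (V (inner ℝ n.1 ξ.1)) hr.le ξ
  rw [secondForm_add_swap (advMetric_symm N E)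
    (advMetric_mul_inv (by rw [axisSurface, hrad]; exact hr)
      (by rw [axisSurface, ev, hrad]; exact hE0)),
    push_axisField ha hb hc, push_axisField ha hb hc, tangent_axisSurface hV hR,
    tangent_axisSurface hV hR, axisSurface, axisField, dot_advMetric _ _ _ hr,
    dot_advMetric _ _ _ hr, sum_pd_advMetric _ hr _ hN hE]
  have h1 : ∀ A, inner ℝ (pushIncl ξ (basisVec A)) ξ.1 = (0 : ℝ) := fun A => by
    rw [real_inner_comm, inner_pushIncl]
  have h2 : ∀ A, inner ℝ (pushIncl ξ (basisVec A)) n.1 = axisComp n.1 ξ A := fun A => by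
    rw [real_inner_comm, axisComp]
  have h3 : ∀ A, inner ℝ n.1 (pushIncl ξ (basisVec A)) = axisComp n.1 ξ A := fun A => rfl
  have h4 : ∀ A B, inner ℝ (pushIncl ξ (basisVec A)) (pushIncl ξ (basisVec B))
    = roundForm ξ A B := fun A B => rfl
  have h5 : (inner ℝ ξ.1 n.1 : ℝ) = inner ℝ n.1 ξ.1 := real_inner_comm _ _
  simp only [inner_add_left, inner_add_right, inner_sub_left, inner_sub_right, inner_smul_left,
    inner_smul_right, RCLike.conj_to_real, inner_self_sphere, inner_pushIncl, h1, h2, h3, h4, h5,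
    roundForm_symm ξ B A]
  have := hr.ne'
  field_simp
  ring

end

/-! ### Null normals and expansions of an axisymmetric surface -/

section

section AxialFunctions

variable (N E : ℝ × ℝ → ℝ) (V R : ℝ → ℝ)

/-- The `∂_r`-component of the normal field with components `a` along `∂_v` and `y` along `-ℓ`. -/
def normalB (a y : ℝ → ℝ) (z : ℝ) : ℝ := (y z + N (V z, R z) * a z) / E (V z, R z)

/-- The component tangent to the round spheres of the normal field with components `a`, `y`. -/
def normalC (a y : ℝ → ℝ) (z : ℝ) : ℝ :=
  -(y z * deriv V z + E (V z, R z) * a z * deriv R z) / R z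

/-- This is `|dz|²` on the round sphere of radius `R`. -/
def axMu (z : ℝ) : ℝ := (1 - z ^ 2) / R z ^ 2

/-- The coefficient of the axial part of the first fundamental form. -/
def axP (z : ℝ) : ℝ :=
  -N (V z, R z) * deriv V z ^ 2 + 2 * E (V z, R z) * deriv V z * deriv R z

/-- The area element is `R² √D`. -/
def axD (z : ℝ) : ℝ := 1 + axMu R z * axP N E V R z

/-- For a normal with components `(a, y)`, where `y = g(X, ∂_v)`, the null condition is `K a² + 2H a
y + μ V'² y² = 0` with `H = 1 + μ E R' V'` and reduced discriminant `H² - K μ V'² = D`. Setting `S =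
H + √D`, the two null directions are `y/a = -K/S` and `a/y = -μV'²/S`. These forms of the roots stay
regular where `K` or `V'` vanishes, in particular on the undeformed sphere. -/
def axS (z : ℝ) : ℝ :=
  1 + axMu R z * E (V z, R z) * deriv R z * deriv V z + Real.sqrt (axD N E V R z)

def axK (z : ℝ) : ℝ := N (V z, R z) + axMu R z * (E (V z, R z) * deriv R z) ^ 2

/-- The `y`-component of the outgoing null normal, whose `a`-component is one. -/
def outY (z : ℝ) : ℝ := -(axK N E V R z / axS N E V R z)

/-- The components of the ingoing null normal. -/
def inA (z : ℝ) : ℝ := axMu R z * deriv V z ^ 2 / (2 * axD N E V R z)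

/-- The components of the ingoing null normal. -/
def inY (z : ℝ) : ℝ := -(axS N E V R z / (2 * axD N E V R z))

/-- The part of the second fundamental form proportional to the round metric. -/
def traceA (a y : ℝ → ℝ) (z : ℝ) : ℝ :=
  R z * (normalB N E V R a y z - normalC E V R a y z * z)

/-- The axial part of the second fundamental form. -/
def traceB (a y : ℝ → ℝ) (z : ℝ) : ℝ :=
  (derivV N (V z, R z) * deriv V z + derivR N (V z, R z) * deriv R z) * a z * deriv V z
  - (derivV E (V z, R z) * deriv V z + derivR E (V z, R z) * deriv R z)
    * (deriv V z * normalB N E V R a y z + a z * deriv R z)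
  - 2 * deriv R z * normalC E V R a y z - y z * deriv (deriv V) z
  - E (V z, R z) * a z * deriv (deriv R) z
  - (derivV N (V z, R z) * a z + derivR N (V z, R z) * normalB N E V R a y z) * deriv V z ^ 2 / 2
  + (derivV E (V z, R z) * a z + derivR E (V z, R z) * normalB N E V R a y z)
    * deriv V z * deriv R z

/-- The expansion of the normal field with components `a`, `y`, up to a positive factor. -/
def axTrace (a y : ℝ → ℝ) (z : ℝ) : ℝ :=
  2 * R z ^ 2 * traceA N E V R a y z
    + (R z ^ 2 * traceB N E V R a y z + axP N E V R z * traceA N E V R a y z) * (1 - z ^ 2)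

end AxialFunctions

variable {N E : ℝ × ℝ → ℝ} {V R : ℝ → ℝ} {n : S2}

lemma hasDerivAt_comp_curve {G : ℝ × ℝ → ℝ} {z : ℝ} (hG : DifferentiableAt ℝ G (V z, R z))
    (hV : DifferentiableAt ℝ V z) (hR : DifferentiableAt ℝ R z) :
    HasDerivAt (fun t => G (V t, R t))
      (derivV G (V z, R z) * deriv V z + derivR G (V z, R z) * deriv R z) z := by
  have := HasFDerivAt.comp_hasDerivAt z (f := fun t => (V t, R t)) hG.hasFDerivAt
    (hV.hasDerivAt.prodMk hR.hasDerivAt)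
  rw [fderiv_eq_derivV_derivR] at this
  exact this

/-- The derivatives of `a` and `y` cancel because the field is orthogonal to the tangent vectors.
Hence only values of `a` and `y` enter `traceA` and `traceB`, and no derivative of the square root
has to be estimated. -/
lemma secondForm_normal {a y : ℝ → ℝ} {ξ : S2} {z : ℝ} (hz : z = inner ℝ n.1 ξ.1)
    (hV : ContDiff ℝ ∞ V) (hR : ContDiff ℝ ∞ R) (ha : DifferentiableAt ℝ a z)
    (hy : DifferentiableAt ℝ y z) (hr : 0 < R z)
    (hN : DifferentiableAt ℝ N (V z, R z)) (hE : DifferentiableAt ℝ E (V z, R z))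
    (hE0 : E (V z, R z) ≠ 0) (A B : Fin 2) :
    secondForm (advMetric N E) (axisSurface n V R)
        (axisField n a (normalB N E V R a y) (normalC E V R a y)) ξ A B
      + secondForm (advMetric N E) (axisSurface n V R)
        (axisField n a (normalB N E V R a y) (normalC E V R a y)) ξ B A =
      2 * (traceA N E V R a y z * roundForm ξ A B
        + traceB N E V R a y z * (axisComp n.1 ξ A * axisComp n.1 ξ B)) := by
  have dV : DifferentiableAt ℝ V z := hV.contDiffAt.differentiableAt (by simp)
  have dR : DifferentiableAt ℝ R z := hR.contDiffAt.differentiableAt (by simp)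
  have dV' : DifferentiableAt ℝ (deriv V) z :=
    ((contDiff_infty_iff_deriv.1 hV).2.contDiffAt).differentiableAt (by simp)
  have dR' : DifferentiableAt ℝ (deriv R) z :=
    ((contDiff_infty_iff_deriv.1 hR).2.contDiffAt).differentiableAt (by simp)
  have hNz := hasDerivAt_comp_curve hN dV dR
  have hEz := hasDerivAt_comp_curve hE dV dR
  have hb : HasDerivAt (normalB N E V R a y) _ z :=
    (hy.hasDerivAt.add (hNz.mul ha.hasDerivAt)).div hEz hE0
  have hc : HasDerivAt (normalC E V R a y) _ z :=
    ((hy.hasDerivAt.mul dV'.hasDerivAt).add ((hEz.mul ha.hasDerivAt).mul dR'.hasDerivAt)).neg.div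
      dR.hasDerivAt hr.ne'
  rw [secondForm_axisSurface hz dV.hasDerivAt dR.hasDerivAt ha.hasDerivAt hb hc hr hN hE hE0]
  simp only [traceA, traceB, normalB, normalC, Pi.add_apply, Pi.mul_apply, Pi.neg_apply]
  have hr' := hr.ne'
  field_simp
  ring

/-- The positive factor between `expansion` and `axTrace` is `R⁴ D`. -/
lemma expansion_normal {a y : ℝ → ℝ} {ξ : S2} {z : ℝ} (hz : z = inner ℝ n.1 ξ.1)
    (hV : ContDiff ℝ ∞ V) (hR : ContDiff ℝ ∞ R) (ha : DifferentiableAt ℝ a z)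
    (hy : DifferentiableAt ℝ y z) (hr : 0 < R z)
    (hN : DifferentiableAt ℝ N (V z, R z)) (hE : DifferentiableAt ℝ E (V z, R z))
    (hE0 : E (V z, R z) ≠ 0) (hD : 0 < axD N E V R z) (hT : axTrace N E V R a y z < 0) :
    expansion (advMetric N E) (axisSurface n V R)
        (axisField n a (normalB N E V R a y) (normalC E V R a y)) ξ < 0 := by
  have dV : DifferentiableAt ℝ V z := hV.contDiffAt.differentiableAt (by simp)
  have dR : DifferentiableAt ℝ R z := hR.contDiffAt.differentiableAt (by simp)
  have hpos : 0 < R z ^ 2 + axP N E V R z * (1 - z ^ 2) := by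
    have : R z ^ 2 + axP N E V R z * (1 - z ^ 2) = R z ^ 2 * axD N E V R z := by
      have hr' := hr.ne'
      simp only [axD, axMu]; field_simp
    rw [this]; positivity
  have key := expansion_mul_eq (n := n) (ξ := ξ) (q := R z ^ 2) (P := axP N E V R z)
    (fun A B => by subst hz; exact firstForm_axisSurface dV.hasDerivAt dR.hasDerivAt hr A B)
    (secondForm_normal hz hV hR ha hy hr hN hE hE0) (by positivity) (by rw [← hz]; exact hpos.ne')
  rw [← hz] at key
  have h2 : 0 < R z ^ 2 * (R z ^ 2 + axP N E V R z * (1 - z ^ 2)) := by positivity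
  have h3 : expansion (advMetric N E) (axisSurface n V R)
      (axisField n a (normalB N E V R a y) (normalC E V R a y)) ξ
      * (R z ^ 2 * (R z ^ 2 + axP N E V R z * (1 - z ^ 2))) < 0 := by
    rw [key]; exact hT
  exact neg_of_mul_neg_left h3 h2.le

lemma dot_normal_normal {ξ : S2} {z : ℝ} (hz : z = inner ℝ n.1 ξ.1) (hr : 0 < R z)
    (hE0 : E (V z, R z) ≠ 0) (a y a₂ y₂ : ℝ → ℝ) :
    dot (advMetric N E) (axisSurface n V R ξ)
      (axisField n a (normalB N E V R a y) (normalC E V R a y) ξ)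
      (axisField n a₂ (normalB N E V R a₂ y₂) (normalC E V R a₂ y₂) ξ) =
      axK N E V R z * a z * a₂ z
      + (1 + axMu R z * E (V z, R z) * deriv R z * deriv V z) * (a z * y₂ z + a₂ z * y z)
      + axMu R z * deriv V z ^ 2 * y z * y₂ z := by
  rw [dot_axisField_axisField (hz ▸ hr) _ _ _ _ _ _ hz]
  simp only [normalB, normalC, axK, axMu]
  have hr' := hr.ne'
  field_simp
  ring

lemma dot_normal_tangent {ξ : S2} {z : ℝ} (hz : z = inner ℝ n.1 ξ.1)
    (hV : DifferentiableAt ℝ V z) (hR : DifferentiableAt ℝ R z) (hr : 0 < R z)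
    (hE0 : E (V z, R z) ≠ 0) (a y : ℝ → ℝ) (A : Fin 2) :
    dot (advMetric N E) (axisSurface n V R ξ)
      (axisField n a (normalB N E V R a y) (normalC E V R a y) ξ)
      (tangent (axisSurface n V R) ξ A) = 0 := by
  rw [dot_axisField_tangent hz hV.hasDerivAt hR.hasDerivAt hr]
  simp only [normalB, normalC]
  have hr' := hr.ne'
  field_simp
  ring

/-- This is the quadratic equation for `S`, free of square roots; the three scalar products below
reduce to it. -/
lemma sqrt_axD_sq {z : ℝ} (hD : 0 < axD N E V R z) :
    (axS N E V R z - (1 + axMu R z * E (V z, R z) * deriv R z * deriv V z)) ^ 2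
      = 1 + axMu R z * axP N E V R z := by
  have : axS N E V R z - (1 + axMu R z * E (V z, R z) * deriv R z * deriv V z)
    = Real.sqrt (axD N E V R z) := by simp only [axS]; ring
  rw [this, Real.sq_sqrt hD.le]; rfl

lemma dot_out_out {ξ : S2} {z : ℝ} (hz : z = inner ℝ n.1 ξ.1) (hr : 0 < R z)
    (hE0 : E (V z, R z) ≠ 0) (hD : 0 < axD N E V R z) (hS : 0 < axS N E V R z) :
    dot (advMetric N E) (axisSurface n V R ξ)
      (axisField n (fun _ => 1) (normalB N E V R (fun _ => 1) (outY N E V R))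
        (normalC E V R (fun _ => 1) (outY N E V R)) ξ)
      (axisField n (fun _ => 1) (normalB N E V R (fun _ => 1) (outY N E V R))
        (normalC E V R (fun _ => 1) (outY N E V R)) ξ) = 0 := by
  have h := sqrt_axD_sq hD
  rw [dot_normal_normal hz hr hE0]
  have hS' := hS.ne'
  simp only [outY]
  field_simp
  simp only [axK, axP] at *
  linear_combination (N (V z, R z) + axMu R z * (E (V z, R z) * deriv R z) ^ 2) * h

lemma dot_in_in {ξ : S2} {z : ℝ} (hz : z = inner ℝ n.1 ξ.1) (hr : 0 < R z)
    (hE0 : E (V z, R z) ≠ 0) (hD : 0 < axD N E V R z) :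
    dot (advMetric N E) (axisSurface n V R ξ)
      (axisField n (inA N E V R) (normalB N E V R (inA N E V R) (inY N E V R))
        (normalC E V R (inA N E V R) (inY N E V R)) ξ)
      (axisField n (inA N E V R) (normalB N E V R (inA N E V R) (inY N E V R))
        (normalC E V R (inA N E V R) (inY N E V R)) ξ) = 0 := by
  have h := sqrt_axD_sq hD
  rw [dot_normal_normal hz hr hE0]
  have hD' := hD.ne'
  simp only [inA, inY]
  field_simp
  simp only [axK, axP] at *
  linear_combination (axMu R z * deriv V z ^ 2) * h

/-- The factor `1/(2D)` in `inA` and `inY` is the one that makes this product `-1`. -/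
lemma dot_out_in {ξ : S2} {z : ℝ} (hz : z = inner ℝ n.1 ξ.1) (hr : 0 < R z)
    (hE0 : E (V z, R z) ≠ 0) (hD : 0 < axD N E V R z) (hS : 0 < axS N E V R z) :
    dot (advMetric N E) (axisSurface n V R ξ)
      (axisField n (fun _ => 1) (normalB N E V R (fun _ => 1) (outY N E V R))
        (normalC E V R (fun _ => 1) (outY N E V R)) ξ)
      (axisField n (inA N E V R) (normalB N E V R (inA N E V R) (inY N E V R))
        (normalC E V R (inA N E V R) (inY N E V R)) ξ) = -1 := by
  have h := sqrt_axD_sq hD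
  have hD2 : axD N E V R z = 1 + axMu R z * axP N E V R z := rfl
  rw [dot_normal_normal hz hr hE0]
  have hD' := hD.ne'
  have hS' := hS.ne'
  simp only [outY, inA, inY]
  field_simp
  rw [hD2]
  simp only [axK, axP] at *
  linear_combination
    (-(1 + axMu R z * E (V z, R z) * deriv R z * deriv V z)) * h

end

/-! ### From conditions on the profile functions to trapped spheres -/

section

variable {N E : ℝ × ℝ → ℝ} {V R : ℝ → ℝ} {n : S2}

lemma inner_mem_Icc (n ξ : S2) : (inner ℝ n.1 ξ.1 : ℝ) ∈ Set.Icc (-1) 1 := by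
  have h := abs_real_inner_le_norm n.1 ξ.1
  rw [norm_eq_of_mem_sphere, norm_eq_of_mem_sphere, mul_one] at h
  exact abs_le.1 h

lemma contMDiff_axisField {a b c : ℝ → ℝ} (ha : ∀ z ∈ Set.Icc (-1 : ℝ) 1, ContDiffAt ℝ ∞ a z)
    (hb : ∀ z ∈ Set.Icc (-1 : ℝ) 1, ContDiffAt ℝ ∞ b z)
    (hc : ∀ z ∈ Set.Icc (-1 : ℝ) 1, ContDiffAt ℝ ∞ c z) :
    ContMDiff (𝓡 2) 𝓘(ℝ, R4) ∞ (axisField n a b c) := by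
  intro ξ
  have := fact_finrank_three
  have hz : ContDiffAt ℝ ∞ (fun w : EuclideanSpace ℝ (Fin 3) => (inner ℝ n.1 w : ℝ)) ξ.1 :=
    (innerSL ℝ n.1).contDiff.contDiffAt
  have hmem := inner_mem_Icc n ξ
  have hamb : ContDiffAt ℝ ∞ (fun w : EuclideanSpace ℝ (Fin 3) =>
      vec4L (a (inner ℝ n.1 w), b (inner ℝ n.1 w) • w
        + c (inner ℝ n.1 w) • (n.1 - (inner ℝ n.1 w : ℝ) • w))) ξ.1 :=
    vec4L.contDiff.contDiffAt.comp ξ.1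
      (((ha _ hmem).comp ξ.1 hz).prodMk ((((hb _ hmem).comp ξ.1 hz).smul contDiffAt_id).add
        (((hc _ hmem).comp ξ.1 hz).smul (contDiffAt_const.sub (hz.smul contDiffAt_id)))))
  exact hamb.contMDiffAt.comp ξ (contMDiff_coe_sphere (n := 2) ξ)

/-- Sufficient conditions at `⟪n, ξ⟫ = z` for the surface `v = V`, `r = R` to be trapped. -/
structure TrappedAt (N E : ℝ × ℝ → ℝ) (U : Set (ℝ × ℝ)) (V R : ℝ → ℝ) (z : ℝ) : Prop where
  pos : 0 < R z
  mem : (V z, R z) ∈ U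
  area_pos : 0 < axD N E V R z
  normal_pos : 0 < axS N E V R z
  out_future : outY N E V R z + N (V z, R z) / 2 - 1 < 0
  in_future : inY N E V R z + inA N E V R z * (N (V z, R z) / 2 - 1) < 0
  out_trapped : axTrace N E V R (fun _ => 1) (outY N E V R) z < 0
  in_trapped : axTrace N E V R (inA N E V R) (inY N E V R) z < 0

section Smooth

variable {z : ℝ}

lemma contDiffAt_curve {G : ℝ × ℝ → ℝ} (hG : ContDiffAt ℝ ∞ G (V z, R z))
    (hV : ContDiff ℝ ∞ V) (hR : ContDiff ℝ ∞ R) : ContDiffAt ℝ ∞ (fun t => G (V t, R t)) z :=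
  hG.comp z (hV.contDiffAt.prodMk hR.contDiffAt)

lemma contDiffAt_axMu (hR : ContDiff ℝ ∞ R) (hr : 0 < R z) : ContDiffAt ℝ ∞ (axMu R) z :=
  ContDiffAt.div (by fun_prop) (hR.contDiffAt.pow 2) (by positivity)

lemma contDiffAt_axD (hN : ContDiffAt ℝ ∞ N (V z, R z)) (hE : ContDiffAt ℝ ∞ E (V z, R z))
    (hV : ContDiff ℝ ∞ V) (hR : ContDiff ℝ ∞ R) (hr : 0 < R z) :
    ContDiffAt ℝ ∞ (axD N E V R) z := by
  have h1 := contDiffAt_axMu hR hr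
  have h2 := contDiffAt_curve hN hV hR
  have h3 := contDiffAt_curve hE hV hR
  have h4 := (contDiff_infty_iff_deriv.1 hV).2
  have h5 := (contDiff_infty_iff_deriv.1 hR).2
  unfold axD axP
  fun_prop

lemma contDiffAt_axS (hN : ContDiffAt ℝ ∞ N (V z, R z)) (hE : ContDiffAt ℝ ∞ E (V z, R z))
    (hV : ContDiff ℝ ∞ V) (hR : ContDiff ℝ ∞ R) (hr : 0 < R z) (hD : 0 < axD N E V R z) :
    ContDiffAt ℝ ∞ (axS N E V R) z := by
  have h1 := contDiffAt_axMu hR hr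
  have h2 := (contDiffAt_axD hN hE hV hR hr).sqrt hD.ne'
  have h3 := contDiffAt_curve hE hV hR
  have h4 := (contDiff_infty_iff_deriv.1 hV).2
  have h5 := (contDiff_infty_iff_deriv.1 hR).2
  unfold axS
  fun_prop

lemma contDiffAt_outY (hN : ContDiffAt ℝ ∞ N (V z, R z)) (hE : ContDiffAt ℝ ∞ E (V z, R z))
    (hV : ContDiff ℝ ∞ V) (hR : ContDiff ℝ ∞ R) (hr : 0 < R z) (hD : 0 < axD N E V R z)
    (hS : 0 < axS N E V R z) : ContDiffAt ℝ ∞ (outY N E V R) z := by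
  have h1 := contDiffAt_axMu hR hr
  have h2 := contDiffAt_curve hN hV hR
  have h3 := contDiffAt_curve hE hV hR
  have h5 := (contDiff_infty_iff_deriv.1 hR).2
  have h6 : ContDiffAt ℝ ∞ (axK N E V R) z := by unfold axK; fun_prop
  exact (h6.div (contDiffAt_axS hN hE hV hR hr hD) hS.ne').neg

lemma contDiffAt_inA (hN : ContDiffAt ℝ ∞ N (V z, R z)) (hE : ContDiffAt ℝ ∞ E (V z, R z))
    (hV : ContDiff ℝ ∞ V) (hR : ContDiff ℝ ∞ R) (hr : 0 < R z) (hD : 0 < axD N E V R z) :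
    ContDiffAt ℝ ∞ (inA N E V R) z := by
  have h1 := contDiffAt_axMu hR hr
  have h4 := (contDiff_infty_iff_deriv.1 hV).2
  have h6 : ContDiffAt ℝ ∞ (fun z => axMu R z * deriv V z ^ 2) z := by fun_prop
  exact h6.div (contDiffAt_const.mul (contDiffAt_axD hN hE hV hR hr)) (by positivity)

lemma contDiffAt_inY (hN : ContDiffAt ℝ ∞ N (V z, R z)) (hE : ContDiffAt ℝ ∞ E (V z, R z))
    (hV : ContDiff ℝ ∞ V) (hR : ContDiff ℝ ∞ R) (hr : 0 < R z) (hD : 0 < axD N E V R z) :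
    ContDiffAt ℝ ∞ (inY N E V R) z :=
  ((contDiffAt_axS hN hE hV hR hr hD).div
    (contDiffAt_const.mul (contDiffAt_axD hN hE hV hR hr)) (by positivity)).neg

lemma contDiffAt_normalB {a y : ℝ → ℝ} (hN : ContDiffAt ℝ ∞ N (V z, R z))
    (hE : ContDiffAt ℝ ∞ E (V z, R z)) (hV : ContDiff ℝ ∞ V) (hR : ContDiff ℝ ∞ R)
    (hE0 : E (V z, R z) ≠ 0) (ha : ContDiffAt ℝ ∞ a z) (hy : ContDiffAt ℝ ∞ y z) :
    ContDiffAt ℝ ∞ (normalB N E V R a y) z :=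
  (hy.add ((contDiffAt_curve hN hV hR).mul ha)).div (contDiffAt_curve hE hV hR) hE0

lemma contDiffAt_normalC {a y : ℝ → ℝ} (hE : ContDiffAt ℝ ∞ E (V z, R z)) (hV : ContDiff ℝ ∞ V)
    (hR : ContDiff ℝ ∞ R) (hr : 0 < R z) (ha : ContDiffAt ℝ ∞ a z) (hy : ContDiffAt ℝ ∞ y z) :
    ContDiffAt ℝ ∞ (normalC E V R a y) z := by
  have h4 := (contDiff_infty_iff_deriv.1 hV).2
  have h5 := (contDiff_infty_iff_deriv.1 hR).2
  exact ((hy.mul h4.contDiffAt).add (((contDiffAt_curve hE hV hR).mul ha).mul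
    h5.contDiffAt)).neg.div hR.contDiffAt hr.ne'

end Smooth

/-- The surface is a radial graph: the direction of the spatial part recovers `ξ`. -/
lemma axisSurface_injective (hR : ∀ z ∈ Set.Icc (-1 : ℝ) 1, 0 < R z) :
    Function.Injective (axisSurface n V R) := by
  intro ξ η h
  have hξ := hR _ (inner_mem_Icc n ξ)
  have hη := hR _ (inner_mem_Icc n η)
  have hrad := congrArg rad h
  have hdr := congrArg dr h
  simp only [axisSurface] at hrad hdr
  rw [dr_vec4 _ hξ, dr_vec4 _ hη] at hdr
  apply Subtype.ext
  ext i
  fin_cases i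
  · exact congrFun hdr 1
  · exact congrFun hdr 2
  · exact congrFun hdr 3

lemma lapseN_eq (α m : ℝ × ℝ → ℝ) (q : ℝ × ℝ) :
    lapseN α m q = expA α q ^ 2 * (1 - 2 * m q / q.2) := by
  simp only [lapseN, expA]
  rw [← Real.exp_nat_mul]; norm_num

lemma timeDir_axisSurface (α m : ℝ × ℝ → ℝ) {ξ : S2} {z : ℝ} (hz : z = inner ℝ n.1 ξ.1)
    (hr : 0 < R z) :
    timeDir α m (axisSurface n V R ξ) = axisField n (fun _ => 1)
      (fun _ => (lapseN α m (V z, R z) / 2 - 1) / expA α (V z, R z)) (fun _ => 0) ξ := by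
  subst hz
  have he : Real.exp (α (V (inner ℝ n.1 ξ.1), R (inner ℝ n.1 ξ.1))) ≠ 0 := Real.exp_ne_zero _
  have h0 : ∀ w, vec4 (V (inner ℝ n.1 ξ.1)) w 0 = V (inner ℝ n.1 ξ.1) := fun _ => rfl
  rw [lapseN_eq]
  simp only [timeDir, kSph, lSph, axisSurface, axisField, dr_vec4 _ hr, ev, rad_vec4 _ hr.le, h0,
    expA, Real.exp_neg]
  ext i
  fin_cases i <;> simp [dv, vec4] <;> field_simp <;> ring

lemma dot_timeDir {α m : ℝ × ℝ → ℝ} {ξ : S2} {z : ℝ} (hz : z = inner ℝ n.1 ξ.1) (hr : 0 < R z)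
    (a y : ℝ → ℝ) :
    dot (advMetric (lapseN α m) (expA α)) (axisSurface n V R ξ)
      (axisField n a (normalB (lapseN α m) (expA α) V R a y) (normalC (expA α) V R a y) ξ)
      (timeDir α m (axisSurface n V R ξ)) = y z + a z * (lapseN α m (V z, R z) / 2 - 1) := by
  have he : expA α (V z, R z) ≠ 0 := Real.exp_ne_zero _
  rw [timeDir_axisSurface α m hz hr,
    dot_axisField_axisField (hz ▸ hr) _ _ _ _ _ _ hz]
  simp only [normalB, normalC]
  field_simp
  ring

lemma mem_spacetime_axisSurface {U : Set (ℝ × ℝ)} {ξ : S2} {z : ℝ} (hz : z = inner ℝ n.1 ξ.1)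
    (hr : 0 < R z) : axisSurface n V R ξ ∈ spacetime U ↔ (V z, R z) ∈ U := by
  subst hz
  simp only [spacetime, Set.mem_ofPred_eq, axisSurface, rad_vec4 _ hr.le]
  rfl

/-- All geometric requirements depend on `ξ` only through `z`, so the trapping problem becomes a
family of scalar inequalities on `[-1, 1]`. -/
theorem isFutureTrappedSphere_axisSurface {U : Set (ℝ × ℝ)} (hU : IsOpen U) {α m : ℝ × ℝ → ℝ}
    (hN : ContDiffOn ℝ ∞ (lapseN α m) U) (hE : ContDiffOn ℝ ∞ (expA α) U)
    (hV : ContDiff ℝ ∞ V) (hR : ContDiff ℝ ∞ R)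
    (h : ∀ z ∈ Set.Icc (-1 : ℝ) 1, TrappedAt (lapseN α m) (expA α) U V R z) :
    IsFutureTrappedSphere (metric α m) (timeDir α m) (spacetime U) (axisSurface n V R) := by
  have hE0 : ∀ q, expA α q ≠ 0 := fun q => Real.exp_ne_zero _
  have cN : ∀ z ∈ Set.Icc (-1 : ℝ) 1, ContDiffAt ℝ ∞ (lapseN α m) (V z, R z) :=
    fun z hz => hN.contDiffAt (hU.mem_nhds (h z hz).mem)
  have cE : ∀ z ∈ Set.Icc (-1 : ℝ) 1, ContDiffAt ℝ ∞ (expA α) (V z, R z) :=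
    fun z hz => hE.contDiffAt (hU.mem_nhds (h z hz).mem)
  have dV : ∀ z, DifferentiableAt ℝ V z := fun z => hV.contDiffAt.differentiableAt (by simp)
  have dR : ∀ z, DifferentiableAt ℝ R z := fun z => hR.contDiffAt.differentiableAt (by simp)
  have cOut : ∀ z ∈ Set.Icc (-1 : ℝ) 1, ContDiffAt ℝ ∞ (outY (lapseN α m) (expA α) V R) z :=
    fun z hz => contDiffAt_outY (cN z hz) (cE z hz) hV hR (h z hz).pos (h z hz).area_pos
      (h z hz).normal_pos
  have cInA : ∀ z ∈ Set.Icc (-1 : ℝ) 1, ContDiffAt ℝ ∞ (inA (lapseN α m) (expA α) V R) z :=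
    fun z hz => contDiffAt_inA (cN z hz) (cE z hz) hV hR (h z hz).pos (h z hz).area_pos
  have cInY : ∀ z ∈ Set.Icc (-1 : ℝ) 1, ContDiffAt ℝ ∞ (inY (lapseN α m) (expA α) V R) z :=
    fun z hz => contDiffAt_inY (cN z hz) (cE z hz) hV hR (h z hz).pos (h z hz).area_pos
  have hI := inner_mem_Icc n
  rw [metric_eq_advMetric]
  refine ⟨?_, axisSurface_injective fun z hz => (h z hz).pos, ?_, ?_, ?_⟩
  · rw [axisSurface_eq]
    exact contMDiff_axisField (fun z _ => hV.contDiffAt) (fun z _ => hR.contDiffAt)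
      (fun z _ => contDiffAt_const)
  · intro ξ
    exact (mem_spacetime_axisSurface rfl (h _ (hI ξ)).pos).2 (h _ (hI ξ)).mem
  · intro ξ
    have hz := h _ (hI ξ)
    refine firstForm_posDef (n := n) (q := R (inner ℝ n.1 ξ.1) ^ 2)
      (P := axP (lapseN α m) (expA α) V R (inner ℝ n.1 ξ.1))
      (fun A B => firstForm_axisSurface (dV _).hasDerivAt (dR _).hasDerivAt hz.pos A B)
      (pow_pos hz.pos 2) ?_
    have := mul_pos (pow_pos hz.pos 2) hz.area_pos
    have hr' := hz.pos.ne'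
    simp only [axD, axMu] at this
    field_simp at this
    linarith
  · have normal : ∀ (a y : ℝ → ℝ), (∀ z ∈ Set.Icc (-1 : ℝ) 1, ContDiffAt ℝ ∞ a z) →
        (∀ z ∈ Set.Icc (-1 : ℝ) 1, ContDiffAt ℝ ∞ y z) →
        (∀ ξ : S2, dot (advMetric (lapseN α m) (expA α)) (axisSurface n V R ξ)
          (axisField n a (normalB (lapseN α m) (expA α) V R a y) (normalC (expA α) V R a y) ξ)
          (axisField n a (normalB (lapseN α m) (expA α) V R a y) (normalC (expA α) V R a y) ξ)
          = 0) →
        (∀ z ∈ Set.Icc (-1 : ℝ) 1, y z + a z * (lapseN α m (V z, R z) / 2 - 1) < 0) →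
        IsFutureNullNormal (advMetric (lapseN α m) (expA α)) (timeDir α m) (axisSurface n V R)
          (axisField n a (normalB (lapseN α m) (expA α) V R a y) (normalC (expA α) V R a y)) := by
      intro a y ha hy hnull hfut
      refine ⟨contMDiff_axisField ha ?_ ?_, hnull, ?_, ?_⟩
      · exact fun z hz => contDiffAt_normalB (cN z hz) (cE z hz) hV hR (hE0 _) (ha z hz) (hy z hz)
      · exact fun z hz => contDiffAt_normalC (cE z hz) hV hR (h z hz).pos (ha z hz) (hy z hz)
      · exact fun ξ A => dot_normal_tangent rfl (dV _) (dR _) (h _ (hI ξ)).pos (hE0 _) a y A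
      · intro ξ
        rw [dot_timeDir rfl (h _ (hI ξ)).pos]
        exact hfut _ (hI ξ)
    have ddN : ∀ ξ : S2, DifferentiableAt ℝ (lapseN α m)
        (V (inner ℝ n.1 ξ.1), R (inner ℝ n.1 ξ.1)) :=
      fun ξ => (cN _ (hI ξ)).differentiableAt (by simp)
    have ddE : ∀ ξ : S2, DifferentiableAt ℝ (expA α)
        (V (inner ℝ n.1 ξ.1), R (inner ℝ n.1 ξ.1)) :=
      fun ξ => (cE _ (hI ξ)).differentiableAt (by simp)
    refine ⟨_, _, normal (fun _ => 1) (outY (lapseN α m) (expA α) V R)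
        (fun z _ => contDiffAt_const) cOut (fun ξ => ?_) (fun z hz => ?_),
      normal (inA (lapseN α m) (expA α) V R) (inY (lapseN α m) (expA α) V R) cInA cInY
        (fun ξ => ?_) (fun z hz => (h z hz).in_future), fun ξ => ?_, fun ξ => ⟨?_, ?_⟩⟩
    · exact dot_out_out rfl (h _ (hI ξ)).pos (hE0 _) (h _ (hI ξ)).area_pos (h _ (hI ξ)).normal_pos
    · have := (h z hz).out_future
      linarith
    · exact dot_in_in rfl (h _ (hI ξ)).pos (hE0 _) (h _ (hI ξ)).area_pos
    · exact dot_out_in rfl (h _ (hI ξ)).pos (hE0 _) (h _ (hI ξ)).area_pos (h _ (hI ξ)).normal_pos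
    · exact expansion_normal rfl hV hR (differentiableAt_const _)
        ((cOut _ (hI ξ)).differentiableAt (by simp)) (h _ (hI ξ)).pos (ddN ξ) (ddE ξ) (hE0 _)
        (h _ (hI ξ)).area_pos (h _ (hI ξ)).out_trapped
    · exact expansion_normal rfl hV hR ((cInA _ (hI ξ)).differentiableAt (by simp))
        ((cInY _ (hI ξ)).differentiableAt (by simp)) (h _ (hI ξ)).pos (ddN ξ) (ddE ξ) (hE0 _)
        (h _ (hI ξ)).area_pos (h _ (hI ξ)).in_trapped

end

/-! ### The function `W` on the apparent 3-horizon -/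

section

lemma christoffel_symm {g : MetricField} (hsym : ∀ y a b, g y a b = g y b a) (a b c : Fin 4)
    (x : R4) : christoffel g a b c x = christoffel g a c b x := by
  have hpd : ∀ d, pd d (fun y => g y b c) x = pd d (fun y => g y c b) x := by
    intro d; congr 1; ext y; exact hsym y b c
  simp only [christoffel, hpd]
  congr 1
  exact Finset.sum_congr rfl fun d _ => by ring

lemma roundSphere_eq (v r : ℝ) : roundSphere v r = fun ξ => vec4 v (r • ξ.1) := by
  ext ξ i; fin_cases i <;> simp [roundSphere, vec4]

lemma tangent_roundSphere (v r : ℝ) (ξ : S2) (A : Fin 2) :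
    tangent (roundSphere v r) ξ A = vec4 0 (r • pushIncl ξ (basisVec A)) := by
  -- For constant `V` and `R` the axis is immaterial; `ξ` is an arbitrary choice.
  have h : roundSphere v r = axisSurface ξ (fun _ => v) (fun _ => r) := roundSphere_eq v r
  rw [h, tangent_axisSurface (hasDerivAt_const _ v) (hasDerivAt_const _ r)]
  simp

section Horizon

variable {U : Set (ℝ × ℝ)} {α m : ℝ × ℝ → ℝ} {v r : ℝ}

lemma contDiffOn_lapseN (hr : ∀ q ∈ U, 0 < q.2) (hα : ContDiffOn ℝ ∞ α U)
    (hm : ContDiffOn ℝ ∞ m U) : ContDiffOn ℝ ∞ (lapseN α m) U :=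
  ((contDiffOn_const.mul hα).exp).mul (contDiffOn_const.sub
    ((contDiffOn_const.mul hm).div contDiffOn_snd fun q hq => (hr q hq).ne'))

lemma contDiffOn_expA (hα : ContDiffOn ℝ ∞ α U) : ContDiffOn ℝ ∞ (expA α) U := hα.exp

lemma kSph_horizon (hr0 : 0 < r) (h : r = 2 * m (v, r)) (ξ : S2) :
    kSph α m (roundSphere v r ξ) = dv := by
  have h0 : vec4 v (r • ξ.1) 0 = v := rfl
  simp only [roundSphere_eq, kSph, ev, rad_vec4 v hr0.le, h0]
  rw [← h, div_self hr0.ne']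
  simp

/-- The function `W` of the round spheres in the apparent 3-horizon. -/
lemma wScalar_horizon (hU : IsOpen U) (hr : ∀ q ∈ U, 0 < q.2) (hα : ContDiffOn ℝ ∞ α U)
    (hm : ContDiffOn ℝ ∞ m U) (hq : (v, r) ∈ U) (h : r = 2 * m (v, r)) (ξ : S2) :
    wScalar (metric α m) (roundSphere v r) (fun ξ' => kSph α m (roundSphere v r ξ')) ξ =
      -derivV (lapseN α m) (v, r) / (expA α (v, r) * r) := by
  have hr0 : 0 < r := hr _ hq
  have hN := contDiffOn_lapseN hr hα hm
  have hE := contDiffOn_expA hα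
  have hk : (fun ξ' => kSph α m (roundSphere v r ξ')) = fun _ : S2 => dv := by
    ext ξ' : 1; exact kSph_horizon hr0 h ξ'
  have hdN : DifferentiableAt ℝ (lapseN α m) (v, r) :=
    (hN.contDiffAt (hU.mem_nhds hq)).differentiableAt (by simp)
  have hdE : DifferentiableAt ℝ (expA α) (v, r) :=
    (hE.contDiffAt (hU.mem_nhds hq)).differentiableAt (by simp)
  have hrad := rad_vec4 v hr0.le ξ
  have h0 : vec4 v (r • ξ.1) 0 = v := rfl
  have hrS : rad (roundSphere v r ξ) = r := by rw [roundSphere_eq]; exact hrad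
  have h0S : roundSphere v r ξ 0 = v := rfl
  have hdrS : dr (roundSphere v r ξ) = vec4 0 ξ.1 := by rw [roundSphere_eq]; exact dr_vec4 v hr0 ξ
  have heS : ev (expA α) (roundSphere v r ξ) ≠ 0 := (Real.exp_pos _).ne'
  have hN0 : lapseN α m (v, r) = 0 := by
    rw [lapseN_eq]
    dsimp only
    rw [← h, div_self hr0.ne', sub_self, mul_zero]
  rw [hk, metric_eq_advMetric]
  -- The field `k = ∂_v` has constant components, and by `christoffel_advMetric` the symbols
  -- `Γ^a_{bv}` see only the `v`- and `r`-components of a tangent vector, both zero on a round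
  -- sphere.
  have hcov : ∀ A, covDeriv (advMetric (lapseN α m) (expA α)) (roundSphere v r) (fun _ => dv) ξ A
      = 0 := by
    intro A
    have hpush : push (fun _ : S2 => dv) ξ (basisVec A) = 0 := by
      rw [push_restrict (hasFDerivAt_const dv ξ.1)]; rfl
    ext a
    have hchr : ∀ b, christoffel (advMetric (lapseN α m) (expA α)) a b 0 (roundSphere v r ξ) = _ :=
      fun b => (christoffel_symm (advMetric_symm _ _) a b 0 _).trans
        (christoffel_advMetric (x := roundSphere v r ξ) (by rw [hrS]; exact hr0)
          (by rw [hrS, h0S]; exact hdN)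
          (by rw [hrS, h0S]; exact hdE) heS a b)
    have hin := inner_pushIncl ξ (basisVec A)
    rw [inner_fin_three] at hin
    have hsum : ∀ b, ∑ c, christoffel (advMetric (lapseN α m) (expA α)) a b c (roundSphere v r ξ)
        * tangent (roundSphere v r) ξ A b * dv c =
        christoffel (advMetric (lapseN α m) (expA α)) a b 0 (roundSphere v r ξ)
        * tangent (roundSphere v r) ξ A b := by
      intro b
      rw [Fin.sum_univ_four]; simp [dv]
    simp only [covDeriv, hpush, hsum, hchr]
    rw [tangent_roundSphere, hdrS, Fin.sum_univ_four]
    generalize ev (chrB (lapseN α m) (expA α)) (roundSphere v r ξ) = β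
    generalize vec4 0 ξ.1 a = d
    simp only [dv, vec4, Matrix.cons_val, Pi.zero_apply, PiLp.smul_apply, smul_eq_mul]
    linear_combination (-(β * r * d)) * hin
  have hsec : secondForm (advMetric (lapseN α m) (expA α)) (roundSphere v r) (fun _ => dv) ξ
      = 0 := by
    ext A B
    simp only [secondForm, hcov]
    simp [dot]
  have hexp : expansion (advMetric (lapseN α m) (expA α)) (roundSphere v r) (fun _ => dv) ξ
      = 0 := by
    simp [expansion, hsec]
  have hshear : shearScalar (advMetric (lapseN α m) (expA α)) (roundSphere v r) (fun _ => dv) ξ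
      = 0 := by
    simp [shearScalar, shear, hsec, hexp]
  have hdot : ∀ g : MetricField, ∀ x, dot g x dv dv = g x 0 0 := by
    intro g x
    simp [dot, Fin.sum_univ_four, dv]
  have hmem : roundSphere v r ξ ∈ spacetime U := by
    simp only [spacetime, Set.mem_ofPred_eq, roundSphere_eq, hrad, h0]; exact hq
  have hev : ∀ G : ℝ × ℝ → ℝ, ev G (roundSphere v r ξ) = G (v, r) := by
    intro G; rw [roundSphere_eq]; simp only [ev, hrad, h0]
  have hric := ricci_advMetric hU hr hN hE (fun q => Real.exp_pos _) hmem (by rw [hev, hN0])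
  rw [hev] at hric
  have hg00 : advMetric (lapseN α m) (expA α) (roundSphere v r ξ) 0 0 = 0 := by
    simp [advMetric, hev, hN0, dv, dr_zero]
  -- Since `g_vv = 0` here, the scalar curvature term drops out and `G(k, k) = R_vv`.
  rw [wScalar, hshear, hdot, einstein, Matrix.sub_apply, Matrix.smul_apply, hg00, hric]
  simp only [roundSphere_eq, hrad, h0]
  simp

end Horizon

end

/-! ### Linearization about a marginally trapped round sphere -/

section

open scoped Topology

open Filter

/-- The function `c + ε h`. -/
def perturb (c : ℝ) (h : ℝ → ℝ) (ε : ℝ) (t : ℝ) : ℝ := c + ε * h t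

lemma deriv_perturb {h : ℝ → ℝ} (hh : Differentiable ℝ h) (c ε : ℝ) :
    deriv (perturb c h ε) = perturb 0 (deriv h) ε := by
  ext t
  have : HasDerivAt (perturb c h ε) (ε * deriv h t) t :=
    ((hh t).hasDerivAt.const_mul ε).const_add c
  rw [this.deriv]; simp [perturb]

lemma contDiff_perturb {h : ℝ → ℝ} (hh : ContDiff ℝ ∞ h) (c ε : ℝ) :
    ContDiff ℝ ∞ (perturb c h ε) := by
  unfold perturb; fun_prop

/-- The neighbourhoods of `(0, z)` intersected with `{ε > 0}`. -/
def posNhds (z : ℝ) : Filter (ℝ × ℝ) := 𝓝[{p | 0 < p.1}] (0, z)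

lemma eventually_posNhds_pos (z : ℝ) : ∀ᶠ p in posNhds z, 0 < p.1 :=
  eventually_mem_nhdsWithin

lemma tendsto_fst_posNhds (z : ℝ) : Tendsto (fun p : ℝ × ℝ => p.1) (posNhds z) (𝓝 0) :=
  (continuous_fst.tendsto (0, z)).mono_left nhdsWithin_le_nhds

lemma tendsto_snd_posNhds (z : ℝ) : Tendsto (fun p : ℝ × ℝ => p.2) (posNhds z) (𝓝 z) :=
  (continuous_snd.tendsto (0, z)).mono_left nhdsWithin_le_nhds

lemma tendsto_comp_snd {h : ℝ → ℝ} (hh : Continuous h) (z : ℝ) :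
    Tendsto (fun p : ℝ × ℝ => h p.2) (posNhds z) (𝓝 (h z)) :=
  (hh.tendsto z).comp (tendsto_snd_posNhds z)

lemma tendsto_perturb {h : ℝ → ℝ} (hh : Continuous h) (c z : ℝ) :
    Tendsto (fun p : ℝ × ℝ => perturb c h p.1 p.2) (posNhds z) (𝓝 c) := by
  have := ((tendsto_fst_posNhds z).mul (tendsto_comp_snd hh z)).const_add c
  simpa [perturb] using this

lemma tendsto_perturb_div {h : ℝ → ℝ} (hh : Continuous h) (z : ℝ) :
    Tendsto (fun p : ℝ × ℝ => perturb 0 h p.1 p.2 / p.1) (posNhds z) (𝓝 (h z)) := by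
  refine (tendsto_comp_snd hh z).congr' ?_
  filter_upwards [eventually_posNhds_pos z] with p hp
  simp only [perturb]; field_simp; ring

/-- A property that holds for small `ε > 0` near each point of a compact set holds uniformly. -/
lemma eventually_forall_of_posNhds {P : ℝ → ℝ → Prop} {K : Set ℝ} (hK : IsCompact K)
    (h : ∀ z ∈ K, ∀ᶠ p in posNhds z, P p.1 p.2) : ∀ᶠ ε in 𝓝[>] (0 : ℝ), ∀ z ∈ K, P ε z := by
  have : ∀ᶠ ε in 𝓝 (0 : ℝ), ∀ z ∈ K, 0 < ε → P ε z := by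
    refine hK.eventually_forall_of_forall_eventually fun z hz => ?_
    exact eventually_nhdsWithin_iff.1 (h z hz)
  rw [eventually_nhdsWithin_iff]
  filter_upwards [this] with ε hε hpos z hz
  exact hε z hz hpos

section

variable {v₀ r₀ : ℝ} {f h : ℝ → ℝ} (hf : ContDiff ℝ ∞ f) (hh : ContDiff ℝ ∞ h) (z : ℝ)

include hf hh

lemma tendsto_curve {G : ℝ × ℝ → ℝ} (hG : ContinuousAt G (v₀, r₀)) :
    Tendsto (fun p : ℝ × ℝ => G (perturb v₀ h p.1 p.2, perturb r₀ f p.1 p.2)) (posNhds z)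
      (𝓝 (G (v₀, r₀))) :=
  Tendsto.comp (g := G) hG
    ((tendsto_perturb hh.continuous v₀ z).prodMk_nhds (tendsto_perturb hf.continuous r₀ z))

/-- The difference quotient is taken along directions that converge instead of a fixed one. Letting
`z` vary together with `ε` is what makes uniformity on `[-1, 1]` available by compactness. -/
lemma tendsto_curve_div {G : ℝ × ℝ → ℝ} (hG : DifferentiableAt ℝ G (v₀, r₀))
    (h0 : G (v₀, r₀) = 0) :
    Tendsto (fun p : ℝ × ℝ => G (perturb v₀ h p.1 p.2, perturb r₀ f p.1 p.2) / p.1) (posNhds z)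
      (𝓝 (derivV G (v₀, r₀) * h z + derivR G (v₀, r₀) * f z)) := by
  have hw := (tendsto_comp_snd hh.continuous z).prodMk_nhds (tendsto_comp_snd hf.continuous z)
  have h0' : Tendsto (fun p : ℝ × ℝ => p.1 • (h p.2, f p.2)) (posNhds z) (𝓝 0) := by
    have := (tendsto_fst_posNhds z).smul hw
    rwa [zero_smul] at this
  have hd : Tendsto (fun p : ℝ × ℝ => (p.1)⁻¹ • (p.1 • (h p.2, f p.2))) (posNhds z)
      (𝓝 (h z, f z)) := by
    refine hw.congr' ?_
    filter_upwards [eventually_posNhds_pos z] with p hp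
    rw [smul_smul, inv_mul_cancel₀ hp.ne', one_smul]
  have := (hasFDerivWithinAt_univ.2 hG.hasFDerivAt).lim h0' (Eventually.of_forall fun _ => trivial) hd
  rw [fderiv_eq_derivV_derivR] at this
  refine this.congr fun p => ?_
  rw [h0, sub_zero, smul_eq_mul, div_eq_inv_mul]
  rfl

end

/-- Small perturbations of a marginally trapped round sphere are trapped if the linearized
expansion is negative, and their area element is close to that of the round sphere. -/
theorem eventually_trappedAt {N E : ℝ × ℝ → ℝ} {U : Set (ℝ × ℝ)} (hU : IsOpen U)
    (hr : ∀ q ∈ U, 0 < q.2) (hN : ContDiffOn ℝ ∞ N U) (hE : ContDiffOn ℝ ∞ E U)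
    (hE0 : ∀ q, 0 < E q) {v₀ r₀ : ℝ} (hq : (v₀, r₀) ∈ U) (hN0 : N (v₀, r₀) = 0) {f h : ℝ → ℝ}
    (hf : ContDiff ℝ ∞ f) (hh : ContDiff ℝ ∞ h)
    (hlin : ∀ z ∈ Set.Icc (-1 : ℝ) 1,
      r₀ * (derivV N (v₀, r₀) * h z + derivR N (v₀, r₀) * f z) / E (v₀, r₀) ^ 2 <
        (1 - z ^ 2) * deriv (deriv f) z - 2 * z * deriv f z) :
    ∀ᶠ ε in 𝓝[>] (0 : ℝ), ∀ z ∈ Set.Icc (-1 : ℝ) 1,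
      TrappedAt N E U (perturb v₀ h ε) (perturb r₀ f ε) z ∧
      perturb r₀ f ε z ^ 2 * Real.sqrt (axD N E (perturb v₀ h ε) (perturb r₀ f ε) z) ∈
        Set.Ioo (r₀ ^ 2 / 2) (2 * r₀ ^ 2) := by
  refine eventually_forall_of_posNhds isCompact_Icc fun z hz => ?_
  have cN := hN.contDiffAt (hU.mem_nhds hq)
  have cE := hE.contDiffAt (hU.mem_nhds hq)
  have hr0 : 0 < r₀ := hr _ hq
  have hf1 := (contDiff_infty_iff_deriv.1 hf).2
  have hh1 := (contDiff_infty_iff_deriv.1 hh).2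
  have hf2 := (contDiff_infty_iff_deriv.1 hf1).2
  have hh2 := (contDiff_infty_iff_deriv.1 hh1).2
  have dV : ∀ ε, deriv (perturb v₀ h ε) = perturb 0 (deriv h) ε :=
    deriv_perturb (hh.differentiable (by simp)) v₀
  have dR : ∀ ε, deriv (perturb r₀ f ε) = perturb 0 (deriv f) ε :=
    deriv_perturb (hf.differentiable (by simp)) r₀
  have ddV : ∀ ε, deriv (perturb 0 (deriv h) ε) = perturb 0 (deriv (deriv h)) ε :=
    deriv_perturb (hh1.differentiable (by simp)) 0
  have ddR : ∀ ε, deriv (perturb 0 (deriv f) ε) = perturb 0 (deriv (deriv f)) ε :=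
    deriv_perturb (hf1.differentiable (by simp)) 0
  have pos := eventually_posNhds_pos z
  -- Prefix `t` marks the limit of a quantity, `q` that of its quotient by `ε`, and `ti` limits for
  -- the ingoing normal.
  have te := tendsto_fst_posNhds z
  have tz := tendsto_snd_posNhds z
  have tV := tendsto_perturb hh.continuous v₀ z
  have tR := tendsto_perturb hf.continuous r₀ z
  have tV1 := tendsto_perturb hh1.continuous 0 z
  have tR1 := tendsto_perturb hf1.continuous 0 z
  have tV2 := tendsto_perturb hh2.continuous 0 z
  have tR2 := tendsto_perturb hf2.continuous 0 z
  have qV1 := tendsto_perturb_div hh1.continuous z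
  have qR1 := tendsto_perturb_div hf1.continuous z
  have qV2 := tendsto_perturb_div hh2.continuous z
  have qR2 := tendsto_perturb_div hf2.continuous z
  have tN := tendsto_curve hf hh z cN.continuousAt
  have tE := tendsto_curve hf hh z cE.continuousAt
  have tNv := tendsto_curve hf hh z (contDiffAt_derivV cN).continuousAt
  have tNr := tendsto_curve hf hh z (contDiffAt_derivR cN).continuousAt
  have tEv := tendsto_curve hf hh z (contDiffAt_derivV cE).continuousAt
  have tEr := tendsto_curve hf hh z (contDiffAt_derivR cE).continuousAt
  have qN := tendsto_curve_div hf hh z (cN.differentiableAt (by simp)) hN0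
  rw [hN0] at tN
  set e₀ := E (v₀, r₀)
  set ν := derivV N (v₀, r₀) * h z + derivR N (v₀, r₀) * f z
  have he0 : 0 < e₀ := hE0 _
  have tmu : Tendsto (fun p : ℝ × ℝ => axMu (perturb r₀ f p.1) p.2) (posNhds z)
      (𝓝 ((1 - z ^ 2) / r₀ ^ 2)) := (tendsto_const_nhds.sub (tz.pow 2)).div (tR.pow 2) (by positivity)
  have tP : Tendsto (fun p : ℝ × ℝ => axP N E (perturb v₀ h p.1) (perturb r₀ f p.1) p.2)
      (posNhds z) (𝓝 0) := by
    simp only [axP, dV, dR]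
    simpa using (tN.neg.mul (tV1.pow 2)).add (((tE.const_mul 2).mul tV1).mul tR1)
  have tD : Tendsto (fun p : ℝ × ℝ => axD N E (perturb v₀ h p.1) (perturb r₀ f p.1) p.2)
      (posNhds z) (𝓝 1) := by
    simp only [axD]
    simpa using (tmu.mul tP).const_add 1
  have tS : Tendsto (fun p : ℝ × ℝ => axS N E (perturb v₀ h p.1) (perturb r₀ f p.1) p.2)
      (posNhds z) (𝓝 2) := by
    simp only [axS, dV, dR]
    have := ((((tmu.mul tE).mul tR1).mul tV1).const_add 1).add tD.sqrt
    norm_num at this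
    exact this
  -- The term `μ (E R')²` in `K` is of second order in `ε`, so only the variation `ν` of `N`
  -- remains.
  have qK : Tendsto (fun p : ℝ × ℝ => axK N E (perturb v₀ h p.1) (perturb r₀ f p.1) p.2 / p.1)
      (posNhds z) (𝓝 ν) := by
    have := qN.add ((tmu.mul (tE.pow 2)).mul (tR1.mul qR1))
    simp only [zero_mul, mul_zero, add_zero] at this
    refine this.congr fun p => ?_
    simp only [axK, dR]; ring
  have qY : Tendsto (fun p : ℝ × ℝ => outY N E (perturb v₀ h p.1) (perturb r₀ f p.1) p.2 / p.1)
      (posNhds z) (𝓝 (-(ν / 2))) := by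
    refine (qK.div tS two_ne_zero).neg.congr fun p => ?_
    simp only [outY, Pi.div_apply]; ring
  have tY : Tendsto (fun p : ℝ × ℝ => outY N E (perturb v₀ h p.1) (perturb r₀ f p.1) p.2)
      (posNhds z) (𝓝 0) := by
    have := qY.mul te
    rw [mul_zero] at this
    refine this.congr' ?_
    filter_upwards [pos] with p hp
    exact div_mul_cancel₀ _ hp.ne'
  have qB : Tendsto (fun p : ℝ × ℝ => normalB N E (perturb v₀ h p.1) (perturb r₀ f p.1)
      (fun _ => 1) (outY N E (perturb v₀ h p.1) (perturb r₀ f p.1)) p.2 / p.1)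
      (posNhds z) (𝓝 (ν / (2 * e₀))) := by
    have := (qY.add qN).div tE he0.ne'
    rw [show (-(ν / 2) + ν) / e₀ = ν / (2 * e₀) by field_simp; ring] at this
    refine this.congr fun p => ?_
    simp only [normalB, Pi.div_apply]; ring
  have tB : Tendsto (fun p : ℝ × ℝ => normalB N E (perturb v₀ h p.1) (perturb r₀ f p.1)
      (fun _ => 1) (outY N E (perturb v₀ h p.1) (perturb r₀ f p.1)) p.2)
      (posNhds z) (𝓝 0) := by
    have := (tY.add tN).div tE he0.ne'
    simp only [add_zero, zero_div] at this
    refine this.congr fun p => ?_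
    simp only [normalB, mul_one, Pi.div_apply]
  have qC : Tendsto (fun p : ℝ × ℝ => normalC E (perturb v₀ h p.1) (perturb r₀ f p.1)
      (fun _ => 1) (outY N E (perturb v₀ h p.1) (perturb r₀ f p.1)) p.2 / p.1)
      (posNhds z) (𝓝 (-(e₀ * deriv f z / r₀))) := by
    have := ((qY.mul tV1).add (tE.mul qR1)).neg.div tR hr0.ne'
    rw [show -(-(ν / 2) * 0 + e₀ * deriv f z) / r₀ = -(e₀ * deriv f z / r₀) by ring] at this
    refine this.congr fun p => ?_
    simp only [normalC, dV, dR, Pi.div_apply]; ring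
  have qA : Tendsto (fun p : ℝ × ℝ => traceA N E (perturb v₀ h p.1) (perturb r₀ f p.1)
      (fun _ => 1) (outY N E (perturb v₀ h p.1) (perturb r₀ f p.1)) p.2 / p.1)
      (posNhds z) (𝓝 (r₀ * (ν / (2 * e₀) + e₀ * deriv f z / r₀ * z))) := by
    have := tR.mul (qB.sub (qC.mul tz))
    rw [show ν / (2 * e₀) - -(e₀ * deriv f z / r₀) * z = ν / (2 * e₀) + e₀ * deriv f z / r₀ * z by
      ring] at this
    refine this.congr fun p => ?_
    simp only [traceA]; ring
  have qTB : Tendsto (fun p : ℝ × ℝ => traceB N E (perturb v₀ h p.1) (perturb r₀ f p.1)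
      (fun _ => 1) (outY N E (perturb v₀ h p.1) (perturb r₀ f p.1)) p.2 / p.1)
      (posNhds z) (𝓝 (-(e₀ * deriv (deriv f) z))) := by
    have := (((((((tNv.mul tV1).add (tNr.mul tR1)).mul qV1).sub
      (((tEv.mul tV1).add (tEr.mul tR1)).mul ((qV1.mul tB).add qR1))).sub
      ((tR1.const_mul 2).mul qC)).sub (tY.mul qV2)).sub (tE.mul qR2)).sub
      (((tNv.add (tNr.mul tB)).mul (tV1.mul qV1)).div_const 2) |>.add
      ((tEv.add (tEr.mul tB)).mul (tV1.mul qR1))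
    simp only [mul_zero, zero_mul, add_zero, sub_zero, zero_sub, zero_div] at this
    refine this.congr fun p => ?_
    simp only [traceB, dV, dR, ddV, ddR]; ring
  -- The two pieces of `Δf` come from different places: `-2z f'` from the tangential component of
  -- the normal in `traceA`, and `(1 - z²) f''` from `traceB`.
  have qT : Tendsto (fun p : ℝ × ℝ => axTrace N E (perturb v₀ h p.1) (perturb r₀ f p.1)
      (fun _ => 1) (outY N E (perturb v₀ h p.1) (perturb r₀ f p.1)) p.2 / p.1)
      (posNhds z) (𝓝 (r₀ ^ 2 * e₀ * (r₀ * ν / e₀ ^ 2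
        - ((1 - z ^ 2) * deriv (deriv f) z - 2 * z * deriv f z)))) := by
    have := (((tR.pow 2).const_mul 2).mul qA).add ((((tR.pow 2).mul qTB).add (tP.mul qA)).mul
      (tendsto_const_nhds (x := (1 : ℝ)) |>.sub (tz.pow 2)))
    rw [show r₀ ^ 2 * e₀ * (r₀ * ν / e₀ ^ 2
        - ((1 - z ^ 2) * deriv (deriv f) z - 2 * z * deriv f z)) =
        2 * r₀ ^ 2 * (r₀ * (ν / (2 * e₀) + e₀ * deriv f z / r₀ * z)) +
        (r₀ ^ 2 * -(e₀ * deriv (deriv f) z)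
          + 0 * (r₀ * (ν / (2 * e₀) + e₀ * deriv f z / r₀ * z))) * (1 - z ^ 2) by
      field_simp; ring]
    refine this.congr fun p => ?_
    simp only [axTrace]; ring
  have tiA : Tendsto (fun p : ℝ × ℝ => inA N E (perturb v₀ h p.1) (perturb r₀ f p.1) p.2)
      (posNhds z) (𝓝 0) := by
    have := (tmu.mul (tV1.pow 2)).div (tD.const_mul 2) (by norm_num)
    rw [show (1 - z ^ 2) / r₀ ^ 2 * 0 ^ 2 / (2 * 1) = 0 by ring] at this
    simp only [inA, dV]
    exact this
  have tiY : Tendsto (fun p : ℝ × ℝ => inY N E (perturb v₀ h p.1) (perturb r₀ f p.1) p.2)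
      (posNhds z) (𝓝 (-1)) := by
    have := (tS.div (tD.const_mul 2) (by norm_num)).neg
    rw [show -((2 : ℝ) / (2 * 1)) = -1 by norm_num] at this
    exact this
  have tiB : Tendsto (fun p : ℝ × ℝ => normalB N E (perturb v₀ h p.1) (perturb r₀ f p.1)
      (inA N E (perturb v₀ h p.1) (perturb r₀ f p.1))
      (inY N E (perturb v₀ h p.1) (perturb r₀ f p.1)) p.2) (posNhds z) (𝓝 (-(1 / e₀))) := by
    have := (tiY.add (tN.mul tiA)).div tE he0.ne'
    rw [show (-1 + 0 * 0) / e₀ = -(1 / e₀) by ring] at this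
    exact this
  have tiC : Tendsto (fun p : ℝ × ℝ => normalC E (perturb v₀ h p.1) (perturb r₀ f p.1)
      (inA N E (perturb v₀ h p.1) (perturb r₀ f p.1))
      (inY N E (perturb v₀ h p.1) (perturb r₀ f p.1)) p.2) (posNhds z) (𝓝 0) := by
    have := ((tiY.mul tV1).add ((tE.mul tiA).mul tR1)).neg.div tR hr0.ne'
    rw [show -(-1 * 0 + e₀ * 0 * 0) / r₀ = 0 by ring] at this
    simp only [normalC, dV, dR]
    exact this
  have tiTA : Tendsto (fun p : ℝ × ℝ => traceA N E (perturb v₀ h p.1) (perturb r₀ f p.1)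
      (inA N E (perturb v₀ h p.1) (perturb r₀ f p.1))
      (inY N E (perturb v₀ h p.1) (perturb r₀ f p.1)) p.2) (posNhds z)
      (𝓝 (r₀ * (-(1 / e₀) - 0 * z))) := tR.mul (tiB.sub (tiC.mul tz))
  have tiTB : Tendsto (fun p : ℝ × ℝ => traceB N E (perturb v₀ h p.1) (perturb r₀ f p.1)
      (inA N E (perturb v₀ h p.1) (perturb r₀ f p.1))
      (inY N E (perturb v₀ h p.1) (perturb r₀ f p.1)) p.2) (posNhds z) (𝓝 0) := by
    have := ((((((((tNv.mul tV1).add (tNr.mul tR1)).mul tiA).mul tV1).sub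
      (((tEv.mul tV1).add (tEr.mul tR1)).mul ((tV1.mul tiB).add (tiA.mul tR1)))).sub
      ((tR1.const_mul 2).mul tiC)).sub (tiY.mul tV2)).sub ((tE.mul tiA).mul tR2)).sub
      ((((tNv.mul tiA).add (tNr.mul tiB)).mul (tV1.pow 2)).div_const 2) |>.add
      ((((tEv.mul tiA).add (tEr.mul tiB)).mul tV1).mul tR1)
    simp only [traceB, dV, dR, ddV, ddR]
    simpa using this
  -- The ingoing limit is the strictly negative value on the round sphere, so zeroth order suffices.
  have tiT : Tendsto (fun p : ℝ × ℝ => axTrace N E (perturb v₀ h p.1) (perturb r₀ f p.1)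
      (inA N E (perturb v₀ h p.1) (perturb r₀ f p.1))
      (inY N E (perturb v₀ h p.1) (perturb r₀ f p.1)) p.2) (posNhds z)
      (𝓝 (-(2 * r₀ ^ 3 / e₀))) := by
    have := (((tR.pow 2).const_mul 2).mul tiTA).add ((((tR.pow 2).mul tiTB).add
      (tP.mul tiTA)).mul (tendsto_const_nhds (x := (1 : ℝ)) |>.sub (tz.pow 2)))
    rw [show -(2 * r₀ ^ 3 / e₀) = 2 * r₀ ^ 2 * (r₀ * (-(1 / e₀) - 0 * z)) +
      (r₀ ^ 2 * 0 + 0 * (r₀ * (-(1 / e₀) - 0 * z))) * (1 - z ^ 2) by ring]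
    exact this
  have hT0 : r₀ ^ 2 * e₀ * (r₀ * ν / e₀ ^ 2
        - ((1 - z ^ 2) * deriv (deriv f) z - 2 * z * deriv f z)) < 0 :=
    mul_neg_of_pos_of_neg (by positivity) (sub_neg.2 (hlin z hz))
  have hiT0 : -(2 * r₀ ^ 3 / e₀) < 0 := by
    have : 0 < 2 * r₀ ^ 3 / e₀ := by positivity
    linarith
  have hof := (tY.add (tN.div_const 2)).sub_const 1
  have hif := tiY.add (tiA.mul ((tN.div_const 2).sub_const 1))
  have har := (tR.pow 2).mul tD.sqrt
  rw [Real.sqrt_one, mul_one] at har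
  have hr2 : 0 < r₀ ^ 2 := by positivity
  have hUe := (tV.prodMk_nhds tR).eventually (hU.mem_nhds hq)
  filter_upwards [pos, tR.eventually_const_lt hr0, hUe, tD.eventually_const_lt one_pos,
    tS.eventually_const_lt two_pos, hof.eventually_lt_const (u := 0) (by norm_num),
    hif.eventually_lt_const (u := 0) (by norm_num), qT.eventually_lt_const hT0,
    tiT.eventually_lt_const hiT0,
    har.eventually (Ioo_mem_nhds (half_lt_self hr2) (lt_two_mul_self hr2))]
    with p h0 h1 h2 h3 h4 h5 h6 h7 h8 h9
  exact ⟨⟨h1, h2, h3, h4, h5, h6,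
    (div_neg_iff.1 h7).elim (fun h => absurd h.2 h0.not_gt) And.left, h8⟩, h9⟩

end

/-! ### Choice of the perturbation -/

section

open scoped Topology

open Filter

/-- The Laplacian on the unit sphere of a function of `⟪n, ξ⟫`. -/
def axLaplacian (f : ℝ → ℝ) (z : ℝ) : ℝ := (1 - z ^ 2) * deriv (deriv f) z - 2 * z * deriv f z

/-- There are functions on the sphere whose Laplacian is positive off a small cap and negative at
the centre of the cap. -/
lemma exists_axLaplacian_pos {z₁ : ℝ} (h0 : 0 ≤ z₁) (h1 : z₁ < 1) :
    ∃ f : ℝ → ℝ, ContDiff ℝ ∞ f ∧ ∃ d > 0, (∀ z ∈ Set.Icc (-1) z₁, d < axLaplacian f z) ∧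
      axLaplacian f 1 < -d := by
  have h2 : 0 < 1 - z₁ ^ 2 := by nlinarith
  -- This value gives `M(1 - z²) ≥ 2 > 2z` on `[0, z₁]`; for negative `z` any positive `M` works.
  obtain ⟨M, hM⟩ : ∃ M, M = 2 / (1 - z₁ ^ 2) := ⟨_, rfl⟩
  have hM0 : 0 < M := by rw [hM]; positivity
  have hM2 : M * (1 - z₁ ^ 2) = 2 := by rw [hM]; field_simp
  have d1 : deriv (fun z => Real.exp (M * z)) = fun z => M * Real.exp (M * z) := by
    ext z
    have := ((hasDerivAt_id z).const_mul M).exp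
    rw [show (fun z => Real.exp (M * z)) = fun z => Real.exp (M * id z) from rfl, this.deriv]
    simp; ring
  have d2 : deriv (fun z => M * Real.exp (M * z)) = fun z => M ^ 2 * Real.exp (M * z) := by
    ext z
    rw [deriv_const_mul_field, d1]; ring
  have hL : ∀ z, axLaplacian (fun z => Real.exp (M * z)) z =
      M * Real.exp (M * z) * (M * (1 - z ^ 2) - 2 * z) := by
    intro z
    rw [axLaplacian, d1, d2]; ring
  have hcont : Continuous (axLaplacian fun z => Real.exp (M * z)) := by
    have : axLaplacian (fun z => Real.exp (M * z)) = _ := funext hL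
    rw [this]; fun_prop
  obtain ⟨w, hw, hmin⟩ := (isCompact_Icc (a := (-1 : ℝ)) (b := z₁)).exists_isMinOn
    ⟨0, by norm_num, h0⟩ hcont.continuousOn
  have hpos : ∀ z ∈ Set.Icc (-1) z₁, 0 < axLaplacian (fun z => Real.exp (M * z)) z := by
    intro z hz
    rw [hL]
    refine mul_pos (by positivity) ?_
    have hz1 := hz.1
    have hz2 := hz.2
    rcases lt_or_ge z 0 with hneg | hnn
    · have : 0 ≤ M * (1 - z ^ 2) := mul_nonneg hM0.le (by nlinarith)
      linarith
    · have : M * (1 - z₁ ^ 2) ≤ M * (1 - z ^ 2) :=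
        mul_le_mul_of_nonneg_left (by nlinarith) hM0.le
      linarith
  -- Half the minimum over `[-1, z₁]` makes the first bound strict; the cap `M e^M` gives the
  -- second, because the Laplacian at `z = 1` is `-2M e^M`.
  refine ⟨fun z => Real.exp (M * z), by fun_prop, min (axLaplacian (fun z => Real.exp (M * z)) w / 2)
    (M * Real.exp (M * 1)), ?_, fun z hz => ?_, ?_⟩
  · exact lt_min (half_pos (hpos w hw)) (by positivity)
  · exact (min_le_left _ _).trans_lt ((half_lt_self (hpos w hw)).trans_le (hmin hz))
  · have h3 := min_le_right (axLaplacian (fun z => Real.exp (M * z)) w / 2)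
      (M * Real.exp (M * 1))
    have h4 : 0 < M * Real.exp (M * 1) := by positivity
    have h5 := hL 1
    linarith

/-- The radial profile is `σf`, and the sign `σ` selects the side of the horizon holding all but a
cap. Trapping has the margin `d` for either sign, and `N/ε` tends to a positive multiple of `σΔf -
d`. -/
lemma exists_trapped_curve {N E : ℝ × ℝ → ℝ} {U : Set (ℝ × ℝ)} (hU : IsOpen U)
    (hr : ∀ q ∈ U, 0 < q.2) (hN : ContDiffOn ℝ ∞ N U) (hE : ContDiffOn ℝ ∞ E U)
    (hE0 : ∀ q, 0 < E q) {v₀ r₀ : ℝ} (hq : (v₀, r₀) ∈ U) (hN0 : N (v₀, r₀) = 0)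
    (hNv : derivV N (v₀, r₀) < 0) {z₁ : ℝ} (hz0 : 0 ≤ z₁) (hz1 : z₁ < 1)
    {W : Set (ℝ × ℝ)} (hW : W ∈ 𝓝 (v₀, r₀)) {σ : ℝ} (hσ : σ = 1 ∨ σ = -1) :
    ∃ V R : ℝ → ℝ, ContDiff ℝ ∞ V ∧ ContDiff ℝ ∞ R ∧
      (∀ z ∈ Set.Icc (-1 : ℝ) 1, TrappedAt N E U V R z ∧
        R z ^ 2 * Real.sqrt (axD N E V R z) ∈ Set.Ioo (r₀ ^ 2 / 2) (2 * r₀ ^ 2) ∧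
        derivV N (V z, R z) < 0 ∧ (V z, R z) ∈ W) ∧
      (∀ z ∈ Set.Icc (-1 : ℝ) z₁, 0 < σ * N (V z, R z)) ∧ σ * N (V 1, R 1) < 0 := by
  obtain ⟨f, hf, d, hd, hpos, hneg⟩ := exists_axLaplacian_pos hz0 hz1
  have hr0 : 0 < r₀ := hr _ hq
  have he0 : 0 < E (v₀, r₀) := hE0 _
  have cN := hN.contDiffAt (hU.mem_nhds hq)
  have hf1 := (contDiff_infty_iff_deriv.1 hf).2
  have hf2 := (contDiff_infty_iff_deriv.1 hf1).2
  -- Solved from `N_v h + N_r σf = (σΔf - d) E²/r₀`, which is where `N_v ≠ 0` is indispensable.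
  obtain ⟨h, hh⟩ : ∃ h : ℝ → ℝ, h = fun z => ((σ * axLaplacian f z - d) / r₀ * E (v₀, r₀) ^ 2
    - derivR N (v₀, r₀) * (σ * f z)) / derivV N (v₀, r₀) := ⟨_, rfl⟩
  have hhc : ContDiff ℝ ∞ h := by
    rw [hh]; unfold axLaplacian
    fun_prop
  have hσf : ContDiff ℝ ∞ (fun z => σ * f z) := by fun_prop
  have hν : ∀ z, derivV N (v₀, r₀) * h z + derivR N (v₀, r₀) * (σ * f z) =
      (σ * axLaplacian f z - d) * (E (v₀, r₀) ^ 2 / r₀) := by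
    intro z
    have := hNv.ne
    rw [hh]; field_simp; ring
  have hlap : ∀ z, (1 - z ^ 2) * deriv (deriv fun z => σ * f z) z
      - 2 * z * deriv (fun z => σ * f z) z = σ * axLaplacian f z := by
    intro z
    have e1 : deriv (fun z => σ * f z) = fun z => σ * deriv f z := by
      ext z; exact deriv_const_mul_field σ
    rw [e1, deriv_const_mul_field]
    simp only [axLaplacian]; ring
  have ev1 := eventually_trappedAt hU hr hN hE hE0 hq hN0 hσf hhc (fun z _ => by
    rw [hν, hlap]
    have : r₀ * ((σ * axLaplacian f z - d) * (E (v₀, r₀) ^ 2 / r₀)) / E (v₀, r₀) ^ 2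
      = σ * axLaplacian f z - d := by field_simp
    rw [this]; linarith)
  have ev2 : ∀ᶠ ε in 𝓝[>] (0 : ℝ), ∀ z ∈ Set.Icc (-1 : ℝ) 1,
      derivV N (perturb v₀ h ε z, perturb r₀ (fun z => σ * f z) ε z) < 0 :=
    eventually_forall_of_posNhds isCompact_Icc fun z _ =>
      (tendsto_curve hσf hhc z (contDiffAt_derivV cN).continuousAt).eventually_lt_const hNv
  have ev3 : ∀ᶠ ε in 𝓝[>] (0 : ℝ), ∀ z ∈ Set.Icc (-1 : ℝ) 1,
      (perturb v₀ h ε z, perturb r₀ (fun z => σ * f z) ε z) ∈ W :=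
    eventually_forall_of_posNhds isCompact_Icc fun z _ =>
      ((tendsto_perturb hhc.continuous v₀ z).prodMk_nhds
        (tendsto_perturb hσf.continuous r₀ z)).eventually hW
  have hquot : ∀ z, Tendsto (fun p : ℝ × ℝ => σ * (N (perturb v₀ h p.1 p.2,
      perturb r₀ (fun z => σ * f z) p.1 p.2) / p.1)) (posNhds z)
      (𝓝 (σ * ((σ * axLaplacian f z - d) * (E (v₀, r₀) ^ 2 / r₀)))) := by
    intro z
    rw [← hν]
    exact (tendsto_curve_div hσf hhc z (cN.differentiableAt (by simp)) hN0).const_mul σ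
  have hc0 : 0 < E (v₀, r₀) ^ 2 / r₀ := by positivity
  have hσ2 : σ * σ = 1 := by rcases hσ with rfl | rfl <;> norm_num
  have ev4 : ∀ᶠ ε in 𝓝[>] (0 : ℝ), ∀ z ∈ Set.Icc (-1 : ℝ) z₁,
      0 < σ * N (perturb v₀ h ε z, perturb r₀ (fun z => σ * f z) ε z) := by
    refine eventually_forall_of_posNhds isCompact_Icc fun z hz => ?_
    have hlim : 0 < σ * ((σ * axLaplacian f z - d) * (E (v₀, r₀) ^ 2 / r₀)) := by
      -- This product equals `Δf - σd`. The two-sided margin, `Δf > d` off the cap and `Δf < -d` at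
      -- its centre, fixes its sign for both values of `σ`.
      have h1 : 0 < σ * (σ * axLaplacian f z - d) := by
        have := hpos z hz
        rcases hσ with rfl | rfl <;> linarith
      rw [← mul_assoc]; positivity
    filter_upwards [(hquot z).eventually_const_lt hlim, eventually_posNhds_pos z] with p h1 h2
    rw [← mul_div_assoc] at h1
    exact (div_pos_iff_of_pos_right h2).1 h1
  have ev5 : ∀ᶠ ε in 𝓝[>] (0 : ℝ), ∀ z ∈ ({1} : Set ℝ),
      σ * N (perturb v₀ h ε z, perturb r₀ (fun z => σ * f z) ε z) < 0 := by
    refine eventually_forall_of_posNhds isCompact_singleton fun z hz => ?_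
    rw [Set.mem_singleton_iff.1 hz]
    have hlim : σ * ((σ * axLaplacian f 1 - d) * (E (v₀, r₀) ^ 2 / r₀)) < 0 := by
      rw [← mul_assoc]
      refine mul_neg_of_neg_of_pos ?_ hc0
      rcases hσ with rfl | rfl <;> linarith
    filter_upwards [(hquot 1).eventually_lt_const hlim, eventually_posNhds_pos 1] with p h1 h2
    rw [← mul_div_assoc] at h1
    by_contra hcon
    exact absurd h1 (not_lt.2 (div_nonneg (not_lt.1 hcon) h2.le))
  obtain ⟨ε, h1, h2, h3, h4, h5⟩ :=
    (ev1.and (ev2.and (ev3.and (ev4.and ev5)))).exists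
  exact ⟨_, _, contDiff_perturb hhc v₀ ε, contDiff_perturb hσf r₀ ε,
    fun z hz => ⟨(h1 z hz).1, (h1 z hz).2, h2 z hz, h3 z hz⟩, h4, h5 1 rfl⟩

end

/-! ### Small caps and their area -/

section

open scoped Topology

open Filter MeasureTheory

/-- The surface measure of the unit sphere. -/
abbrev sphereMeasure : Measure S2 := (volume : Measure (EuclideanSpace ℝ (Fin 3))).toSphere

open scoped Pointwise in
-- The cone over a point lies in a line, which is null in three-space.
lemma sphereMeasure_singleton (n : S2) : sphereMeasure {n} = 0 := by
  rw [sphereMeasure, Measure.toSphere_apply' _ (measurableSet_singleton n)]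
  have hsub : Set.Ioo (0 : ℝ) 1 • ((↑) '' ({n} : Set S2) : Set (EuclideanSpace ℝ (Fin 3))) ⊆
      ((Submodule.span ℝ {n.1} : Submodule ℝ (EuclideanSpace ℝ (Fin 3))) : Set _) := by
    rintro _ ⟨t, _, w, ⟨ξ, hξ, rfl⟩, rfl⟩
    rw [Set.mem_singleton_iff.1 hξ]
    exact Submodule.smul_mem _ _ (Submodule.mem_span_singleton_self _)
  have htop : (Submodule.span ℝ {n.1} : Submodule ℝ (EuclideanSpace ℝ (Fin 3))) ≠ ⊤ := by
    intro h
    have h1 := finrank_span_singleton (K := ℝ) (ne_zero_of_mem_unit_sphere n)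
    rw [h, finrank_top, finrank_euclideanSpace_fin] at h1
    norm_num at h1
  rw [measure_mono_null hsub (Measure.addHaar_submodule _ _ htop), mul_zero]

/-- Spherical caps about `n` of small radius have small measure. -/
lemma exists_cap_lt (n : S2) {c : ℝ≥0∞} (hc : 0 < c) (t : ℝ) (ht : t < 1) :
    ∃ z : ℝ, 0 ≤ z ∧ t ≤ z ∧ z < 1 ∧ sphereMeasure {ξ | z < inner ℝ n.1 ξ.1} < c := by
  have hcont : Continuous fun ξ : S2 => (inner ℝ n.1 ξ.1 : ℝ) := by fun_prop
  set s : ℕ → Set S2 := fun k => {ξ | 1 - 1 / ((k : ℝ) + 1) < inner ℝ n.1 ξ.1} with hs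
  have hmeas : ∀ k, MeasurableSet (s k) := fun k =>
    (isOpen_lt continuous_const hcont).measurableSet
  have hanti : Antitone s := by
    intro k l hkl ξ hξ
    have : 1 / ((l : ℝ) + 1) ≤ 1 / ((k : ℝ) + 1) := Nat.one_div_le_one_div hkl
    simp only [hs, Set.mem_ofPred_eq] at hξ ⊢
    linarith
  have hlim := tendsto_measure_iInter_atTop (μ := sphereMeasure)
    (fun k => (hmeas k).nullMeasurableSet) hanti ⟨0, measure_ne_top _ _⟩
  -- The caps shrink to points with `⟪n, ξ⟫ = 1`, which by equality in Cauchy–Schwarz is `n` alone;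
  -- continuity from above then applies.
  have hsub : (⋂ k, s k) ⊆ {n} := by
    intro ξ hξ
    have hge : (1 : ℝ) ≤ inner ℝ n.1 ξ.1 := by
      have h0 : Tendsto (fun k : ℕ => 1 - 1 / ((k : ℝ) + 1)) atTop (𝓝 (1 - 0)) :=
        tendsto_one_div_add_atTop_nhds_zero_nat.const_sub 1
      rw [sub_zero] at h0
      exact le_of_tendsto' h0 fun k => (Set.mem_iInter.1 hξ k).le
    have h1 : inner ℝ n.1 ξ.1 = (1 : ℝ) := by
      have := (inner_mem_Icc n ξ).2
      linarith
    have := (inner_eq_one_iff_of_norm_eq_one (norm_eq_of_mem_sphere n)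
      (norm_eq_of_mem_sphere ξ)).1 h1
    exact (Subtype.ext this).symm
  rw [measure_mono_null hsub (sphereMeasure_singleton n)] at hlim
  have h0 : Tendsto (fun k : ℕ => 1 - 1 / ((k : ℝ) + 1)) atTop (𝓝 (1 - 0)) :=
    tendsto_one_div_add_atTop_nhds_zero_nat.const_sub 1
  rw [sub_zero] at h0
  obtain ⟨k, hk1, hk2⟩ := ((hlim.eventually_lt_const hc).and (h0.eventually_const_lt ht)).exists
  refine ⟨1 - 1 / ((k : ℝ) + 1), ?_, hk2.le, ?_, hk1⟩
  · have : 1 / ((k : ℝ) + 1) ≤ 1 := by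
      rw [div_le_one (by positivity)]
      have : (0 : ℝ) ≤ k := Nat.cast_nonneg k
      linarith
    linarith
  · have : 0 < 1 / ((k : ℝ) + 1) := by positivity
    linarith

lemma area_axisSurface {N E : ℝ × ℝ → ℝ} {V R : ℝ → ℝ} (hV : ContDiff ℝ ∞ V)
    (hR : ContDiff ℝ ∞ R) (n : S2) (hr : ∀ z ∈ Set.Icc (-1 : ℝ) 1, 0 < R z) (P : Set S2) :
    area (advMetric N E) (axisSurface n V R) P = ∫⁻ ξ in P, ENNReal.ofReal
      (R (inner ℝ n.1 ξ.1) ^ 2 * Real.sqrt (axD N E V R (inner ℝ n.1 ξ.1))) ∂sphereMeasure := by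
  unfold area
  congr 1
  ext ξ
  congr 1
  have hpos := hr _ (inner_mem_Icc n ξ)
  have hdet := firstForm_det (n := n) (ξ := ξ) (g := advMetric N E) (Φ := axisSurface n V R)
    (fun A B => firstForm_axisSurface
      (hV.contDiffAt.differentiableAt (by simp)).hasDerivAt
      (hR.contDiffAt.differentiableAt (by simp)).hasDerivAt hpos A B)
  rw [hdet, mul_div_cancel_left₀ _ (roundForm_det_pos ξ).ne']
  have e : ∀ ρ p t : ℝ, 0 < ρ → Real.sqrt (ρ ^ 2 * (ρ ^ 2 + p * (1 - t ^ 2)))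
      = ρ ^ 2 * Real.sqrt (1 + (1 - t ^ 2) / ρ ^ 2 * p) := by
    intro ρ p t hρ
    rw [show ρ ^ 2 * (ρ ^ 2 + p * (1 - t ^ 2)) = (ρ ^ 2) ^ 2 * (1 + (1 - t ^ 2) / ρ ^ 2 * p) by
      field_simp, Real.sqrt_mul (by positivity), Real.sqrt_sq (by positivity)]
  rw [e _ _ _ hpos]
  rfl

/-- The upper and lower bounds on the area element differ by a factor 4; hence the fraction `ε / 4`
demanded of the cap. -/
lemma area_lt {N E : ℝ × ℝ → ℝ} {V R : ℝ → ℝ} (hV : ContDiff ℝ ∞ V)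
    (hR : ContDiff ℝ ∞ R) (n : S2) (hr : ∀ z ∈ Set.Icc (-1 : ℝ) 1, 0 < R z) {r₀ ε z₁ : ℝ}
    (hr0 : 0 < r₀) (hε : 0 < ε)
    (hbd : ∀ z ∈ Set.Icc (-1 : ℝ) 1,
      R z ^ 2 * Real.sqrt (axD N E V R z) ∈ Set.Ioo (r₀ ^ 2 / 2) (2 * r₀ ^ 2))
    (hcap : sphereMeasure {ξ | z₁ < inner ℝ n.1 ξ.1} <
      ENNReal.ofReal (ε / 4) * sphereMeasure Set.univ)
    {P : Set S2} (hP : P ⊆ {ξ | z₁ < inner ℝ n.1 ξ.1}) :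
    area (advMetric N E) (axisSurface n V R) P <
      ENNReal.ofReal ε * area (advMetric N E) (axisSurface n V R) Set.univ := by
  rw [area_axisSurface hV hR n hr, area_axisSurface hV hR n hr]
  have hc : 0 < 2 * r₀ ^ 2 := by positivity
  calc ∫⁻ ξ in P, ENNReal.ofReal
        (R (inner ℝ n.1 ξ.1) ^ 2 * Real.sqrt (axD N E V R (inner ℝ n.1 ξ.1))) ∂sphereMeasure
      ≤ ∫⁻ _ in P, ENNReal.ofReal (2 * r₀ ^ 2) ∂sphereMeasure :=
        lintegral_mono fun ξ => ENNReal.ofReal_le_ofReal (hbd _ (inner_mem_Icc n ξ)).2.le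
    _ = ENNReal.ofReal (2 * r₀ ^ 2) * sphereMeasure P := setLIntegral_const _ _
    _ ≤ ENNReal.ofReal (2 * r₀ ^ 2) * sphereMeasure {ξ | z₁ < inner ℝ n.1 ξ.1} := by
        gcongr
    _ < ENNReal.ofReal (2 * r₀ ^ 2) * (ENNReal.ofReal (ε / 4) * sphereMeasure Set.univ) :=
        ENNReal.mul_lt_mul_right (by simpa using hr0.ne') ENNReal.ofReal_ne_top hcap
    _ = ENNReal.ofReal ε * (ENNReal.ofReal (r₀ ^ 2 / 2) * sphereMeasure Set.univ) := by
        rw [← mul_assoc, ← mul_assoc, ← ENNReal.ofReal_mul hc.le, ← ENNReal.ofReal_mul hε.le]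
        congr 2; ring
    _ = ENNReal.ofReal ε * ∫⁻ _ in Set.univ, ENNReal.ofReal (r₀ ^ 2 / 2) ∂sphereMeasure := by
        rw [setLIntegral_const]
    _ ≤ _ := by
        gcongr with ξ
        exact (hbd _ (inner_mem_Icc n ξ)).1.le

/-- A neighbourhood of a point of a round sphere contains the points of nearby spheres in a small
cap. -/
lemma exists_neighborhood_cap {O : Set R4} (hO : IsOpen O) {n : S2} {v₀ r₀ : ℝ}
    (hp : vec4 v₀ (r₀ • n.1) ∈ O) :
    ∃ W ∈ 𝓝 (v₀, r₀), ∃ t < 1, ∀ q ∈ W, ∀ ξ : S2, t < inner ℝ n.1 ξ.1 →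
      vec4 q.1 (q.2 • ξ.1) ∈ O := by
  have hcont : Continuous fun p : (ℝ × ℝ) × EuclideanSpace ℝ (Fin 3) => vec4 p.1.1 (p.1.2 • p.2) :=
    vec4L.continuous.comp ((continuous_fst.comp continuous_fst).prodMk
      ((continuous_snd.comp continuous_fst).smul continuous_snd))
  have hmem : (fun p : (ℝ × ℝ) × EuclideanSpace ℝ (Fin 3) => vec4 p.1.1 (p.1.2 • p.2)) ⁻¹' O ∈
      𝓝 ((v₀, r₀), n.1) := (hO.preimage hcont).mem_nhds hp
  rw [nhds_prod_eq] at hmem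
  obtain ⟨W, hW, B, hB, hWB⟩ := Filter.mem_prod_iff.1 hmem
  obtain ⟨δ, hδ, hball⟩ := Metric.mem_nhds_iff.1 hB
  -- On the unit sphere `‖ξ - n‖² = 2 - 2⟪n, ξ⟫`, so this threshold means distance less than `δ`.
  refine ⟨W, hW, 1 - δ ^ 2 / 2, by have : 0 < δ ^ 2 / 2 := by positivity
                                   linarith, fun q hq ξ hξ => ?_⟩
  refine hWB (Set.mk_mem_prod hq (hball ?_))
  rw [Metric.mem_ball, dist_eq_norm]
  have h1 : ‖ξ.1 - n.1‖ ^ 2 < δ ^ 2 := by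
    rw [norm_sub_sq_real, norm_eq_of_mem_sphere, norm_eq_of_mem_sphere, real_inner_comm]
    linarith
  exact lt_of_pow_lt_pow_left₀ 2 hδ.le h1

/-! ### The two sides of the horizon and the final construction -/

section Sides

variable {α m : ℝ × ℝ → ℝ} {v r : ℝ}

lemma lapseN_pos_iff (hr : 0 < r) (ξ : S2) :
    vec4 v (r • ξ.1) ∈ untrappedSide m ↔ 0 < lapseN α m (v, r) := by
  have h0 : vec4 v (r • ξ.1) 0 = v := rfl
  have he : 0 < expA α (v, r) ^ 2 := pow_pos (Real.exp_pos _) 2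
  rw [lapseN_eq, mul_pos_iff_of_pos_left he, sub_pos, div_lt_one hr]
  simp only [untrappedSide, Set.mem_ofPred_eq, ev, rad_vec4 v hr.le, h0]

lemma lapseN_neg_iff (hr : 0 < r) (ξ : S2) :
    vec4 v (r • ξ.1) ∈ trappedSide m ↔ lapseN α m (v, r) < 0 := by
  have h0 : vec4 v (r • ξ.1) 0 = v := rfl
  have he : 0 < expA α (v, r) ^ 2 := pow_pos (Real.exp_pos _) 2
  rw [lapseN_eq, ← neg_pos, ← mul_neg, mul_pos_iff_of_pos_left he, neg_sub, sub_pos, one_lt_div hr]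
  simp only [trappedSide, Set.mem_ofPred_eq, ev, rad_vec4 v hr.le, h0]

end Sides

/-- Both claims are the same construction with opposite `σ`; `S` stands for the side where `σN > 0`.
-/
lemma exists_trapped_surface (U : Set (ℝ × ℝ)) (hU : IsOpen U) (hr : ∀ q ∈ U, 0 < q.2)
    (α m : ℝ × ℝ → ℝ) (hα : ContDiffOn ℝ ∞ α U) (hm : ContDiffOn ℝ ∞ m U)
    {p : R4} (hp : p ∈ nonIsolatedA3H U α m) {O : Set R4} (hO : IsOpen O) (hpO : p ∈ O)
    {ε : ℝ} (hε : 0 < ε) {σ : ℝ} (hσ : σ = 1 ∨ σ = -1) {S : Set R4}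
    (hS : ∀ v r, ∀ ξ : S2, 0 < r → 0 < σ * lapseN α m (v, r) → vec4 v (r • ξ.1) ∈ S) :
    ∃ Φ : S2 → R4, IsFutureTrappedSphere (metric α m) (timeDir α m) (spacetime U) Φ ∧
      CrossesNonIsolatedA3H U α m Φ ∧ PortionOutsideSmall (metric α m) Φ S O ε := by
  obtain ⟨⟨hpU, hp2⟩, n, hpn, hW⟩ := hp
  set v₀ := p 0 with hv0
  set r₀ := rad p with hr0'
  have hq : (v₀, r₀) ∈ U := hpU
  have hr0 : 0 < r₀ := hr _ hq
  have h2m : r₀ = 2 * m (v₀, r₀) := hp2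
  rw [wScalar_horizon hU hr hα hm hq h2m] at hW
  have hE0 : ∀ q, 0 < expA α q := fun q => Real.exp_pos _
  have hNv : derivV (lapseN α m) (v₀, r₀) < 0 := by
    have := (div_pos_iff_of_pos_right (mul_pos (hE0 _) hr0)).1 hW
    linarith
  have hN0 : lapseN α m (v₀, r₀) = 0 := by
    rw [lapseN_eq]; dsimp only
    rw [← h2m, div_self hr0.ne', sub_self, mul_zero]
  have hN := contDiffOn_lapseN hr hα hm
  have hE := contDiffOn_expA hα
  have hpO' : vec4 v₀ (r₀ • n.1) ∈ O := by
    have : p = vec4 v₀ (r₀ • n.1) := by rw [hpn, roundSphere_eq]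
    rwa [this] at hpO
  obtain ⟨W, hWn, t, ht, hWO⟩ := exists_neighborhood_cap hO hpO'
  have hμ : sphereMeasure Set.univ ≠ 0 := by
    have := IsOpen.measure_pos sphereMeasure isOpen_univ ⟨n, trivial⟩
    exact this.ne'
  have hc : 0 < ENNReal.ofReal (ε / 4) * sphereMeasure Set.univ :=
    ENNReal.mul_pos (by simpa using hε) hμ
  -- One cap serves two purposes: its measure controls the area, and `t ≤ z₁` keeps the part of the
  -- surface over it inside `O`.
  obtain ⟨z₁, hz0, htz, hz1, hcap⟩ := exists_cap_lt n hc t ht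
  obtain ⟨V, R, hV, hR, hall, hpos, hneg⟩ :=
    exists_trapped_curve hU hr hN hE hE0 hq hN0 hNv hz0 hz1 hWn hσ
  have hI := inner_mem_Icc n
  have hRpos : ∀ z ∈ Set.Icc (-1 : ℝ) 1, 0 < R z := fun z hz => (hall z hz).1.pos
  have hout : ∀ ξ : S2, axisSurface n V R ξ ∉ S → z₁ < inner ℝ n.1 ξ.1 := by
    intro ξ hξ
    by_contra hcon
    exact hξ (hS _ _ ξ (hRpos _ (hI ξ)) (hpos _ ⟨(hI ξ).1, not_lt.1 hcon⟩))
  have hnn : (inner ℝ n.1 n.1 : ℝ) = 1 := inner_self_sphere n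
  have hnneg : (inner ℝ n.1 (-n).1 : ℝ) = -1 := by
    rw [show (-n).1 = -n.1 from rfl, inner_neg_right, hnn]
  have hm1 : (-1 : ℝ) ∈ Set.Icc (-1 : ℝ) 1 := by norm_num
  have h1 : (1 : ℝ) ∈ Set.Icc (-1 : ℝ) 1 := by norm_num
  have hA := hpos (-1) ⟨le_rfl, by linarith⟩
  have hsurf1 : axisSurface n V R n = vec4 (V 1) (R 1 • n.1) := by rw [axisSurface, hnn]
  have hsurfm1 : axisSurface n V R (-n) = vec4 (V (-1)) (R (-1) • (-n).1) := by
    rw [axisSurface, hnneg]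
  refine ⟨axisSurface n V R, isFutureTrappedSphere_axisSurface hU hN hE hV hR
    fun z hz => (hall z hz).1, ⟨?_, ?_, ?_⟩, ?_, ?_⟩
  -- The points on the two sides are those over `n`, at the centre of the cap, and over `-n`, where
  -- `z = -1`.
  · rcases hσ with rfl | rfl
    · exact ⟨_, ⟨n, hsurf1⟩, (lapseN_neg_iff (hRpos 1 h1) n).2 (by simpa using hneg)⟩
    · exact ⟨_, ⟨-n, hsurfm1⟩, (lapseN_neg_iff (hRpos _ hm1) _).2 (by linarith)⟩
  · rcases hσ with rfl | rfl
    · exact ⟨_, ⟨-n, hsurfm1⟩, (lapseN_pos_iff (hRpos _ hm1) _).2 (by linarith)⟩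
    · exact ⟨_, ⟨n, hsurf1⟩, (lapseN_pos_iff (hRpos 1 h1) n).2 (by linarith)⟩
  -- `N_v < 0` holds along the whole surface, so `W > 0` on the round sphere through any point where
  -- it meets the horizon.
  · rintro _ ⟨⟨ξ, rfl⟩, hA3⟩
    refine ⟨hA3, ξ, ?_⟩
    set z : ℝ := inner ℝ n.1 ξ.1
    have hRz := hRpos z (hI ξ)
    have e1 : rad (axisSurface n V R ξ) = R z := rad_vec4 _ hRz.le ξ
    have e0 : axisSurface n V R ξ 0 = V z := rfl
    have hUz := (hall z (hI ξ)).1.mem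
    have h2 : R z = 2 * m (V z, R z) := by
      have := hA3.2
      rwa [ev, e1, e0] at this
    rw [e1, e0]
    refine ⟨by rw [roundSphere_eq]; rfl, ?_⟩
    rw [wScalar_horizon hU hr hα hm hUz h2]
    exact div_pos (neg_pos.2 (hall z (hI ξ)).2.2.1) (mul_pos (hE0 _) hRz)
  · rintro _ ⟨⟨ξ, rfl⟩, hξ⟩
    exact hWO _ (hall _ (hI ξ)).2.2.2 ξ (htz.trans_lt (hout ξ hξ))
  · exact area_lt hV hR n hRpos hr0 hε (fun z hz => (hall z hz).2.1) hcap fun ξ hξ => hout ξ hξ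

end

end SphSym

end

theorem theorem1 (U : Set (ℝ × ℝ)) (hU : IsOpen U) (hr : ∀ q ∈ U, 0 < q.2)
    (α m : ℝ × ℝ → ℝ) (hα : ContDiffOn ℝ ∞ α U) (hm : ContDiffOn ℝ ∞ m U)
    (p : SphSym.R4) (hp : p ∈ SphSym.nonIsolatedA3H U α m)
    (O : Set SphSym.R4) (hO : IsOpen O) (hpO : p ∈ O) (ε : ℝ) (hε : 0 < ε) :
    (∃ Φ : SphSym.S2 → SphSym.R4,
      SphSym.IsFutureTrappedSphere (SphSym.metric α m) (SphSym.timeDir α m)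
        (SphSym.spacetime U) Φ ∧
      SphSym.CrossesNonIsolatedA3H U α m Φ ∧
      SphSym.PortionOutsideSmall (SphSym.metric α m) Φ (SphSym.untrappedSide m) O ε) ∧
    (∃ Φ : SphSym.S2 → SphSym.R4,
      SphSym.IsFutureTrappedSphere (SphSym.metric α m) (SphSym.timeDir α m)
        (SphSym.spacetime U) Φ ∧
      SphSym.CrossesNonIsolatedA3H U α m Φ ∧
      SphSym.PortionOutsideSmall (SphSym.metric α m) Φ (SphSym.trappedSide m) O ε) :=
  ⟨SphSym.exists_trapped_surface U hU hr α m hα hm hp hO hpO hε (Or.inl rfl)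
      fun _ _ ξ hpos h => (SphSym.lapseN_pos_iff hpos ξ).2 (by simpa using h),
    SphSym.exists_trapped_surface U hU hr α m hα hm hp hO hpO hε (Or.inr rfl)
      fun _ _ ξ hpos h => (SphSym.lapseN_neg_iff hpos ξ).2 (by linarith)⟩
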